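/- Let $F_2=\langle a,b\rangle$ be the free group on $a,b$, and let $\mathrm{Hol}(F_2)=F_2\rtimes\mathrm{Aut}(F_2)$ be its holomorph, with $\mathrm{Aut}(F_2)$ acting tautologically on $F_2$, so that $\varphi w\varphi^{-1}=\varphi(w)$ for $w\in F_2$ and $\varphi\in\mathrm{Aut}(F_2)$ (automorphisms compose as functions). Let $p,x,y\in\mathrm{Aut}(F_2)$ be the automorphisms $$p:\ a\mapsto b,\ b\mapsto a;\qquad x:\ a\mapsto b^{-1},\ b\mapsto a;\qquad y:\ a\mapsto ab^{-1},\ b\mapsto a,$$ and let $\tau_a,\tau_b$ be the inner automorphisms $\tau_a(w)=awa^{-1}$, $\tau_b(w)=bwb^{-1}$. Then every nontrivial element of finite order in $\mathrm{Hol}(F_2)$ is conjugate in $\mathrm{Hol}(F_2)$ to exactly one of the ten elements $$p,\quad px,\quad pxa,\quad px\tau_a,\quad px\tau_a a,\quad x^2,\quad x^2b,\quad y^2\tau_b^{-1},\quad y^2\tau_b^{-1}a,\quad x,$$ whose orders are $2,2,2,2,2,2,2,3,3,4$ respectively. -/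

import Mathlib

namespace HolF2

/-- The free group on two generators. -/
abbrev F2 : Type := FreeGroup (Fin 2)

/-- The holomorph `F₂ ⋊ Aut(F₂)`, where `Aut(F₂)` acts on `F₂` in the tautological way; automorphisms
compose as functions, so `φ * w * φ⁻¹ = φ(w)` holds in the holomorph. -/
abbrev Hol : Type := F2 ⋊[MonoidHom.id (MulAut F2)] MulAut F2

/-- The first free generator `a` of `F₂`. -/
def genA : F2 := FreeGroup.of 0

/-- The second free generator `b` of `F₂`. -/
def genB : F2 := FreeGroup.of 1

/-- The endomorphism of `F₂` with `a ↦ u`, `b ↦ v`. -/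
def endo (u v : F2) : F2 →* F2 := FreeGroup.lift ![u, v]

/-- The automorphism `p`: `a ↦ b`, `b ↦ a`. -/
def autP : MulAut F2 :=
  MonoidHom.toMulEquiv (endo genB genA) (endo genB genA)
    (by ext i; fin_cases i <;> simp [endo, genA, genB])
    (by ext i; fin_cases i <;> simp [endo, genA, genB])

/-- The automorphism `x`: `a ↦ b⁻¹`, `b ↦ a`; its inverse is `a ↦ b`, `b ↦ a⁻¹`. -/
def autX : MulAut F2 :=
  MonoidHom.toMulEquiv (endo genB⁻¹ genA) (endo genB genA⁻¹)
    (by ext i; fin_cases i <;> simp [endo, genA, genB])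
    (by ext i; fin_cases i <;> simp [endo, genA, genB])

/-- The automorphism `y`: `a ↦ a b⁻¹`, `b ↦ a`; its inverse is `a ↦ b`, `b ↦ a⁻¹ b`. -/
def autY : MulAut F2 :=
  MonoidHom.toMulEquiv (endo (genA * genB⁻¹) genA) (endo genB (genA⁻¹ * genB))
    (by ext i; fin_cases i <;> simp [endo, genA, genB])
    (by ext i; fin_cases i <;> simp [endo, genA, genB])

/-- `a` as an element of the holomorph. -/
def a : Hol := SemidirectProduct.inl genA

/-- `b` as an element of the holomorph. -/
def b : Hol := SemidirectProduct.inl genB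

/-- `p` as an element of the holomorph. -/
def p : Hol := SemidirectProduct.inr autP

/-- `x` as an element of the holomorph. -/
def x : Hol := SemidirectProduct.inr autX

/-- `y` as an element of the holomorph. -/
def y : Hol := SemidirectProduct.inr autY

/-- The inner automorphism `τ_a : w ↦ a w a⁻¹`, as an element of the holomorph. -/
def τa : Hol := SemidirectProduct.inr (MulAut.conj genA)

/-- The inner automorphism `τ_b : w ↦ b w b⁻¹`, as an element of the holomorph. -/
def τb : Hol := SemidirectProduct.inr (MulAut.conj genB)

/-- The ten representatives. -/
def rep : Fin 10 → Hol :=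
  ![p, p * x, p * x * a, p * x * τa, p * x * τa * a,
    x ^ 2, x ^ 2 * b, y ^ 2 * τb⁻¹, y ^ 2 * τb⁻¹ * a, x]

/-- The orders of the ten representatives. -/
def repOrder : Fin 10 → ℕ := ![2, 2, 2, 2, 2, 2, 2, 3, 3, 4]

end HolF2

/-! An element `w φ` of the holomorph amounts to the pair of automorphisms `τ_w φ`, `φ`, which have
the same class in Out(F₂); the pair determines the element because the centre is trivial
(`conj_injective`). Conjugacy thus splits into conjugacy in Out(F₂) and, over a fixed outer class,
two twisted conjugacy problems in F₂.

Out(F₂) embeds in GL₂(ℤ): Nielsen reduction (`elementary_eq_top`) generates Aut(F₂) by elementary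
automorphisms, and a normal form drawn from their relations shows that the kernel on the
abelianization is inner (`exists_conj_of_toMat_eq_one`). Gauss reduction (`exists_standard`) brings
a finite-order matrix to one of seven standard ones; it conjugates only by matrices of
automorphisms, so surjectivity onto GL₂(ℤ) is not needed.

Over a standard φ, finite order of `τ_w φ` makes some twisted power `w φ(w) φ²(w) ⋯` trivial. If φ
permutes the letters, cancellation forces `w` to be twisted conjugate to 1 or to a letter inverted
by φ (`ActsOnLetters.exists_of_twistedPow`). The order-three automorphism `autW` does not permute
the letters, but becomes a rotation of the edges of the theta graph (`twConj_autW`). The outer class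
of `y` has no finite-order lift. Symmetries of each outer class merge the remaining pairs into the
ten representatives; trace, determinant, one parity argument on matrices and exponent sums tell
these apart. -/

namespace HolF2

/-! ### Common prefixes of lists. -/

section CommonPrefix

variable {β : Type*} [DecidableEq β]

/-- The length of the longest common prefix of two lists. -/
def commonPrefixLength : List β → List β → ℕ
  | x :: L, y :: M => if x = y then commonPrefixLength L M + 1 else 0
  | [], _ => 0
  | _ :: _, [] => 0

/-- Describing the length by its lower bounds turns symmetry, relabelling and the ultrametric
inequality into facts about equal truncations. -/
theorem le_commonPrefixLength_iff {L M : List β} {k : ℕ} :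
    k ≤ commonPrefixLength L M ↔ k ≤ L.length ∧ k ≤ M.length ∧ L.take k = M.take k := by
  induction L generalizing M k with
  | nil => simp +contextual [commonPrefixLength]
  | cons x L ih =>
    cases M with
    | nil => simp +contextual [commonPrefixLength]
    | cons y M =>
      cases k with
      | zero => simp
      | succ k =>
        by_cases h : x = y
        · simp [commonPrefixLength, h, ih]
        · simp [commonPrefixLength, h]

theorem commonPrefixLength_comm (L M : List β) :
    commonPrefixLength L M = commonPrefixLength M L := by
  apply eq_of_forall_le_iff
  intro k
  simp only [le_commonPrefixLength_iff]
  tauto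

theorem commonPrefixLength_map {γ : Type*} [DecidableEq γ] {f : β → γ} (hf : f.Injective)
    (L M : List β) :
    commonPrefixLength (L.map f) (M.map f) = commonPrefixLength L M := by
  apply eq_of_forall_le_iff
  intro k
  simp only [le_commonPrefixLength_iff, List.length_map, ← List.map_take]
  rw [(List.map_injective_iff.2 hf).eq_iff]

end CommonPrefix

/-! ### Cancellation and Gromov products in free groups. -/

section Length

open FreeGroup

variable {α : Type*} [DecidableEq α]

theorem norm_mk_of_isReduced {L : List (α × Bool)} (h : IsReduced L) :
    (mk L).norm = L.length := by
  rw [FreeGroup.norm, toWord_mk, h.reduce_eq]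

theorem isReduced_invRev {L : List (α × Bool)} (h : IsReduced L) : IsReduced (invRev L) := by
  rw [isReduced_iff_reduce_eq, reduce_invRev, h.reduce_eq]

/-- The common prefix cancels, and once the first letters differ the concatenation is already
reduced. -/
theorem norm_inv_mk_mul_mk {L M : List (α × Bool)} (hL : IsReduced L) (hM : IsReduced M) :
    ((mk L)⁻¹ * mk M).norm + 2 * commonPrefixLength L M = L.length + M.length := by
  induction L generalizing M with
  | nil => simpa [← one_eq_mk, commonPrefixLength] using norm_mk_of_isReduced hM
  | cons x L ih =>
    cases M with
    | nil =>
      rw [← one_eq_mk, mul_one, norm_inv_eq, norm_mk_of_isReduced hL]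
      simp [commonPrefixLength]
    | cons y M =>
      by_cases h : x = y
      · subst h
        have e : (mk (x :: L))⁻¹ * mk (x :: M) = (mk L)⁻¹ * mk M := by
          have e' : ∀ N : List (α × Bool), mk (x :: N) = mk [x] * mk N := fun N => by simp
          rw [e' L, e' M]
          group
        have := ih (hL.infix ⟨[x], [], by simp⟩) (hM.infix ⟨[x], [], by simp; rfl⟩)
        simp only [e, commonPrefixLength, if_true, List.length_cons]
        omega
      · have hr : IsReduced (invRev (x :: L) ++ (y :: M)) := by
          rw [invRev_cons]
          refine IsReduced.append_overlap ?_ ?_ (by simp [invRev])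
          · rw [← invRev_cons]
            exact isReduced_invRev hL
          · simp only [invRev, List.map_cons, List.map_nil, List.reverse_cons, List.reverse_nil,
              List.nil_append, List.cons_append, isReduced_cons_cons]
            refine ⟨fun h1 => ?_, hM⟩
            have h2 : x.2 ≠ y.2 := fun h2 => h (Prod.ext h1 h2)
            revert h2
            cases x.2 <;> cases y.2 <;> simp
        rw [inv_mk, mul_mk, norm_mk_of_isReduced hr]
        simp [commonPrefixLength, h]

/-- The length of the longest common prefix of the reduced words of two elements. -/
def gp (g h : FreeGroup α) : ℕ := commonPrefixLength g.toWord h.toWord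

theorem norm_inv_mul (g h : FreeGroup α) : (g⁻¹ * h).norm + 2 * gp g h = g.norm + h.norm := by
  have := norm_inv_mk_mul_mk (isReduced_toWord (x := g)) (isReduced_toWord (x := h))
  rwa [mk_toWord, mk_toWord] at this

theorem norm_mul (g h : FreeGroup α) : (g * h).norm + 2 * gp g⁻¹ h = g.norm + h.norm := by
  simpa using norm_inv_mul g⁻¹ h

theorem gp_comm (g h : FreeGroup α) : gp g h = gp h g := commonPrefixLength_comm _ _

theorem gp_le_left (g h : FreeGroup α) : gp g h ≤ g.norm :=
  (le_commonPrefixLength_iff.1 le_rfl).1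

/-- The ultrametric inequality of the Cayley tree. -/
theorem le_gp_trans {g h k : FreeGroup α} {n : ℕ} (h₁ : n ≤ gp g h) (h₂ : n ≤ gp h k) :
    n ≤ gp g k := by
  rw [gp, le_commonPrefixLength_iff] at *
  exact ⟨h₁.1, h₂.2.1, h₁.2.2.trans h₂.2.2⟩

theorem gp_eq_of_lt {g h k : FreeGroup α} (hlt : gp g h < gp h k) : gp g k = gp g h := by
  apply le_antisymm
  · by_contra! hc
    have := le_gp_trans (g := g) (h := k) (k := h) (n := gp g h + 1) hc
      (by rw [gp_comm k h]; exact hlt)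
    omega
  · exact le_gp_trans le_rfl hlt.le

/-- Writing `g = c r c⁻¹` with `r` cyclically reduced, `g * g` has length `|g| + |r|`, and `r` is
nonempty. -/
theorem two_mul_gp_inv_self_lt {g : FreeGroup α} (hg : g ≠ 1) : 2 * gp g⁻¹ g < g.norm := by
  have h := norm_mul g g
  have h2 : (g * g).norm = g.norm + (reduceCyclically g.toWord).length := by
    have h3 := toWord_pow g 2
    rw [reduceCyclically.reduce_flatten_replicate isReduced_toWord] at h3
    have h4 := congrArg List.length
      (reduceCyclically.conj_conjugator_reduceCyclically g.toWord)
    simp only [List.length_append, invRev_length] at h4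
    rw [← pow_two, FreeGroup.norm, FreeGroup.norm, h3]
    simp
    omega
  have h5 : 0 < (reduceCyclically g.toWord).length := by
    rw [List.length_pos_iff]
    intro h6
    apply hg
    have h7 := congrArg mk (reduceCyclically.conj_conjugator_reduceCyclically g.toWord)
    rw [h6, mk_toWord, List.append_nil, ← mul_mk, ← inv_mk, mul_inv_cancel] at h7
    exact h7.symm
  omega

theorem exists_prefix (g : FreeGroup α) {k : ℕ} (hk : k ≤ g.norm) :
    ∃ r s : FreeGroup α, g = r * s ∧ r.norm = k ∧ s.norm + k = g.norm := by
  have hred := isReduced_toWord (x := g)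
  have h1 : IsReduced (g.toWord.take k) := hred.infix (List.take_prefix _ _).isInfix
  have h2 : IsReduced (g.toWord.drop k) := hred.infix (List.drop_suffix _ _).isInfix
  refine ⟨mk (g.toWord.take k), mk (g.toWord.drop k), by simp [mk_toWord], ?_, ?_⟩
  · rw [norm_mk_of_isReduced h1, List.length_take]
    exact min_eq_left hk
  · rw [norm_mk_of_isReduced h2, List.length_drop]
    exact Nat.sub_add_cancel hk

/-- If in a chain of elements no factor is used up by the cancellation with its two neighbours,
then the length of the product is at least the number of factors. -/
theorem norm_prod_of_isChain {S : Type*} (val : S → FreeGroup α) (R : S → S → Prop)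
    (hR : ∀ x y z, R x y → R y z →
      gp (val x)⁻¹ (val y) + gp (val y)⁻¹ (val z) < (val y).norm)
    (hext : ∀ y, ∃ z, R y z) (L : List S) (x : S) (hL : (x :: L).IsChain R) (y : S)
    (hyx : R y x) :
    gp (val y)⁻¹ ((x :: L).map val).prod = gp (val y)⁻¹ (val x) ∧
      gp (val y)⁻¹ (val x) + L.length + 1 ≤ ((x :: L).map val).prod.norm := by
  induction L generalizing x y with
  | nil =>
    -- A fictitious right neighbour is enough to see that `val y` does not cancel all of `val x`.
    obtain ⟨z, hz⟩ := hext x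
    have := hR y x z hyx hz
    simp
    omega
  | cons z L ih =>
    rw [List.isChain_cons_cons] at hL
    obtain ⟨ih1, ih2⟩ := ih z hL.2 x hL.1
    have h1 := hR y x z hyx hL.1
    set T' := ((z :: L).map val).prod with hT'
    have hT : ((x :: z :: L).map val).prod = val x * T' := by simp [hT']
    rw [hT]
    have h2 := norm_mul (val x) T'
    have h3 := norm_inv_mul (val x) (val x * T')
    rw [inv_mul_cancel_left] at h3
    -- The part of `val x` that survives in `val x * T'` is longer than what `val y` can cancel, so
    -- `val y` meets the product exactly as it meets `val x`.
    have h4 : gp (val y)⁻¹ (val x) < gp (val x) (val x * T') := by omega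
    refine ⟨gp_eq_of_lt h4, ?_⟩
    simp only [List.length_cons]
    omega

end Length

/-! ### Trivial twisted powers under letter permutations. -/

section Coboundary

open FreeGroup hiding map_inv map_one map_mul

variable {α : Type*}

/-- The formal inverse of a letter. -/
def flipLetter (l : α × Bool) : α × Bool := (l.1, !l.2)

theorem flipLetter_flipLetter (l : α × Bool) : flipLetter (flipLetter l) = l := by
  simp [flipLetter]

theorem inv_mk_singleton (l : α × Bool) : (mk [l])⁻¹ = mk [flipLetter l] := by
  simp [inv_mk, invRev, flipLetter]

/-- The automorphism `φ` permutes the letters of the free group by means of `f`. -/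
structure ActsOnLetters (φ : MulAut (FreeGroup α)) (f : α × Bool → α × Bool) : Prop where
  intro ::
  injective : f.Injective
  map_mk : ∀ l, φ (mk [l]) = mk [f l]

namespace ActsOnLetters

variable {φ : MulAut (FreeGroup α)} {f : α × Bool → α × Bool}

theorem map_mk_list (h : ActsOnLetters φ f) (L : List (α × Bool)) :
    φ (mk L) = mk (L.map f) := by
  induction L with
  | nil => simp [← one_eq_mk]
  | cons x L ih =>
    have e : ∀ (y : α × Bool) (N : List (α × Bool)), mk (y :: N) = mk [y] * mk N :=
      fun y N => by simp
    rw [e x L, map_mul, ih, h.map_mk, List.map_cons, e (f x) (L.map f)]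

variable [DecidableEq α]

theorem mk_singleton_injective {l m : α × Bool} (h : mk [l] = mk [m]) : l = m := by
  have := congrArg toWord h
  simpa [toWord_mk, reduce_singleton] using this

theorem map_flip (h : ActsOnLetters φ f) (l : α × Bool) : f (flipLetter l) = flipLetter (f l) := by
  apply mk_singleton_injective
  rw [← h.map_mk, ← inv_mk_singleton, ← inv_mk_singleton, map_inv, h.map_mk]

theorem isReduced_map (h : ActsOnLetters φ f) {L : List (α × Bool)} (hL : IsReduced L) :
    IsReduced (L.map f) := by
  rw [FreeGroup.IsReduced, List.isChain_map]
  refine List.IsChain.imp ?_ hL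
  intro a b hab h1
  by_contra h2
  have h3 : f b = flipLetter (f a) := by
    refine Prod.ext h1.symm ?_
    revert h2
    simp only [flipLetter]
    cases (f a).2 <;> cases (f b).2 <;> simp
  rw [← h.map_flip] at h3
  have h4 := h.injective h3
  subst h4
  revert hab
  simp [flipLetter]

theorem toWord_map (h : ActsOnLetters φ f) (g : FreeGroup α) :
    (φ g).toWord = g.toWord.map f := by
  conv_lhs => rw [← mk_toWord (x := g)]
  rw [h.map_mk_list, toWord_mk, (h.isReduced_map isReduced_toWord).reduce_eq]

theorem norm_map (h : ActsOnLetters φ f) (g : FreeGroup α) : (φ g).norm = g.norm := by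
  simp [FreeGroup.norm, h.toWord_map]

theorem gp_map (h : ActsOnLetters φ f) (g k : FreeGroup α) : gp (φ g) (φ k) = gp g k := by
  rw [gp, h.toWord_map, h.toWord_map, commonPrefixLength_map h.injective, gp]

end ActsOnLetters

variable [DecidableEq α]

/-- The product `w * φ w * φ² w * ⋯` with `n` factors. -/
def twistedPow {G : Type*} [Group G] (φ : MulAut G) (w : G) (n : ℕ) : G :=
  ((List.range n).map fun i => (φ ^ i) w).prod

theorem twistedPow_succ {G : Type*} [Group G] (φ : MulAut G) (w : G) (n : ℕ) :
    twistedPow φ w (n + 1) = w * φ (twistedPow φ w n) := by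
  simp only [twistedPow, List.range_succ_eq_map, List.map_cons, List.map_map, List.prod_cons,
    pow_zero, MulAut.one_apply, map_list_prod]
  congr 2
  apply List.map_congr_left
  intro i _
  simp [Function.comp, pow_succ']

theorem map_twistedPow {G : Type*} [Group G] (φ : MulAut G) (w : G) (n : ℕ) :
    φ (twistedPow φ w n) = ((List.range n).map fun i => (φ ^ (i + 1)) w).prod := by
  simp [twistedPow, map_list_prod, Function.comp_def, pow_succ']

/-- All factors have the length of `w` and all neighbours cancel equally. If less than half
cancelled on each side, every factor would leave a letter in the product. -/
theorem ActsOnLetters.norm_le_of_twistedPow {φ : MulAut (FreeGroup α)}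
    {f : α × Bool → α × Bool} (h : ActsOnLetters φ f) {w : FreeGroup α} {n : ℕ} (hn : 0 < n)
    (hw : twistedPow φ w n = 1) : w.norm ≤ 2 * gp w⁻¹ (φ w) := by
  by_contra! hlt
  have hnorm : ∀ i : ℕ, ((φ ^ i) w).norm = w.norm := by
    intro i
    induction i with
    | zero => simp
    | succ i ih => rw [pow_succ', MulAut.mul_apply, h.norm_map, ih]
  have hgp : ∀ i : ℕ, gp ((φ ^ i) w)⁻¹ ((φ ^ (i + 1)) w) = gp w⁻¹ (φ w) := by
    intro i
    induction i with
    | zero => simp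
    | succ i ih =>
      rw [← ih, pow_succ' φ i, pow_succ' φ (i + 1), pow_succ' φ i, MulAut.mul_apply,
        MulAut.mul_apply, ← map_inv, h.gp_map, MulAut.mul_apply]
  obtain ⟨m, rfl⟩ := Nat.exists_eq_succ_of_ne_zero hn.ne'
  -- Exponent 0 serves as the left neighbour, so the product runs over exponents 1 to n; it is `φ`
  -- of the twisted power.
  have key := norm_prod_of_isChain (fun i : ℕ => (φ ^ i) w) (fun i j => j = i + 1)
    (by
      rintro i j k rfl rfl
      rw [hgp, hgp, hnorm]
      omega)
    (fun i => ⟨i + 1, rfl⟩) ((List.range m).map (· + 2)) 1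
    (by
      have : 1 :: (List.range m).map (· + 2) = (List.range (m + 1)).map (· + 1) := by
        simp [List.range_succ_eq_map, Function.comp_def]
      rw [this, List.isChain_map, List.isChain_range]
      intros; rfl) 0 rfl
  have e : ((1 :: (List.range m).map (· + 2)).map fun i : ℕ => (φ ^ i) w).prod = 1 := by
    rw [← map_one φ, ← hw, map_twistedPow, List.range_succ_eq_map]
    simp [Function.comp_def]
  rw [e] at key
  simp at key

/-- Twisted powers by a letter permutation vanish only for the obvious reasons: up to twisted
conjugation, such an element is trivial or a letter that is inverted. -/
theorem ActsOnLetters.exists_of_twistedPow {φ : MulAut (FreeGroup α)}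
    {f : α × Bool → α × Bool} (h : ActsOnLetters φ f) {w : FreeGroup α} {n : ℕ} (hn : 0 < n)
    (hw : twistedPow φ w n = 1) :
    ∃ k, w = mk (w.toWord.take k) * (φ (mk (w.toWord.take k)))⁻¹ ∨
      ∃ l, f l = flipLetter l ∧
        w = mk (w.toWord.take k) * mk [l] * (φ (mk (w.toWord.take k)))⁻¹ := by
  have h1 := h.norm_le_of_twistedPow hn hw
  set W := w.toWord with hW
  have hlen : W.length = w.norm := rfl
  have hmk : mk W = w := mk_toWord
  refine ⟨W.length / 2, ?_⟩
  set k := W.length / 2 with hk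
  have h2 : ∀ j, j ≤ gp w⁻¹ (φ w) → (invRev W).take j = (W.map f).take j := by
    intro j hj
    rw [gp, le_commonPrefixLength_iff, toWord_inv, h.toWord_map] at hj
    exact hj.2.2
  have hsplit : ∀ j, j ≤ W.length → (invRev W).take j = invRev (W.drop (W.length - j)) := by
    intro j hj
    conv_lhs => rw [← List.take_append_drop (W.length - j) W, invRev_append]
    rw [List.take_left']
    rw [invRev_length, List.length_drop]
    omega
  -- As far as `w` cancels against `φ w`, its tail is the inverse of `φ` of its head. By `h1` this
  -- reaches the middle of `w`.
  have hdrop : ∀ j, j ≤ gp w⁻¹ (φ w) → j ≤ W.length →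
      mk (W.drop (W.length - j)) = (φ (mk (W.take j)))⁻¹ := by
    intro j hj hj'
    rw [h.map_mk_list, List.map_take, ← h2 j hj, hsplit j hj', inv_mk, invRev_invRev]
  obtain he | ho : W.length = k + k ∨ W.length = k + k + 1 := by omega
  · left
    have := hdrop k (by omega) (by omega)
    rw [he, Nat.add_sub_cancel] at this
    rw [← this, mul_mk, List.take_append_drop, hmk]
  · right
    have hk1 : k < W.length := by omega
    have e1 := hdrop k (by omega) (by omega)
    have e2 := hdrop (k + 1) (by omega) (by omega)
    have i1 : W.length - k = k + 1 := by omega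
    have i2 : W.length - (k + 1) = k := by omega
    rw [i1] at e1
    rw [i2, List.drop_eq_getElem_cons hk1, List.take_succ_eq_append_getElem hk1] at e2
    -- In odd length the cancellation includes the middle letter, and comparing the tails of lengths
    -- `k` and `k + 1` shows that `φ` inverts it.
    refine ⟨W[k], ?_, ?_⟩
    · have e3 : mk (W[k] :: W.drop (k + 1)) = mk [W[k]] * mk (W.drop (k + 1)) := by simp
      rw [e3, e1, ← mul_mk, map_mul, mul_inv_rev, mul_right_cancel_iff, h.map_mk,
        inv_mk_singleton] at e2
      have e4 := ActsOnLetters.mk_singleton_injective e2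
      rw [← flipLetter_flipLetter (f W[k]), ← e4]
    · rw [← e1, mul_mk, mul_mk, ← List.take_succ_eq_append_getElem hk1,
        List.take_append_drop, hmk]

end Coboundary

/-! ### Triviality of the centre. -/

section Center

open FreeGroup hiding map_inv map_one map_mul

/-- Choose a generator other than that of the first letter of `z`. Prepending it leaves the word
reduced, so commuting would make it the first letter of `z`. -/
theorem eq_one_of_commute {α : Type*} [Nontrivial α] {z : FreeGroup α}
    (h : ∀ i, z * of i = of i * z) : z = 1 := by
  classical
  by_contra hz
  obtain ⟨x, L, hx⟩ := List.exists_cons_of_ne_nil (mt toWord_eq_nil_iff.1 hz)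
  obtain ⟨i, hi⟩ := exists_ne x.1
  have hred : IsReduced ((i, true) :: z.toWord) := by
    rw [hx, isReduced_cons_cons, ← hx]
    exact ⟨fun e => absurd e hi, isReduced_toWord⟩
  have e1 : of i * z = mk ((i, true) :: z.toWord) := by
    conv_lhs => rw [← mk_toWord (x := z)]
    rfl
  have e2 : (of i * z).toWord = (i, true) :: z.toWord := by
    rw [e1, toWord_mk, hred.reduce_eq]
  have e3 := toWord_mul_sublist z (of i)
  rw [h, e2, toWord_of] at e3
  have e4 := e3.eq_of_length (by simp)
  rw [hx, List.cons_append, List.cons.injEq] at e4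
  exact hi (by rw [← e4.1])

theorem conj_injective {u v : F2} (h : MulAut.conj u = MulAut.conj v) : u = v := by
  rw [← inv_mul_eq_one]
  apply eq_one_of_commute
  intro i
  have := DFunLike.congr_fun h (of i)
  simp only [MulAut.conj_apply] at this
  have h2 : of i = u⁻¹ * (v * of i * v⁻¹) * u := by rw [← this]; group
  conv_rhs => rw [h2]
  group

end Center

/-! ### Nielsen reduction in rank two. -/

open FreeGroup (mk of toWord)

theorem aut_ext {φ ψ : MulAut F2} (ha : φ genA = ψ genA) (hb : φ genB = ψ genB) : φ = ψ := by
  have : φ.toMonoidHom = ψ.toMonoidHom := by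
    ext i
    fin_cases i
    · exact ha
    · exact hb
  ext w
  exact DFunLike.congr_fun this w

theorem endo_genA (u v : F2) : endo u v genA = u := by simp [endo, genA]

theorem endo_genB (u v : F2) : endo u v genB = v := by simp [endo, genB]

@[simp] theorem autP_genA : autP genA = genB := by
  rw [autP, MonoidHom.toMulEquiv_apply, endo_genA]
@[simp] theorem autP_genB : autP genB = genA := by
  rw [autP, MonoidHom.toMulEquiv_apply, endo_genB]
@[simp] theorem autX_genA : autX genA = genB⁻¹ := by
  rw [autX, MonoidHom.toMulEquiv_apply, endo_genA]
@[simp] theorem autX_genB : autX genB = genA := by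
  rw [autX, MonoidHom.toMulEquiv_apply, endo_genB]
@[simp] theorem autY_genA : autY genA = genA * genB⁻¹ := by
  rw [autY, MonoidHom.toMulEquiv_apply, endo_genA]
@[simp] theorem autY_genB : autY genB = genA := by
  rw [autY, MonoidHom.toMulEquiv_apply, endo_genB]

/-- The reflection `a ↦ a⁻¹`, `b ↦ b`. -/
def autE : MulAut F2 := autP * autX

@[simp] theorem autE_genA : autE genA = genA⁻¹ := by simp [autE]
@[simp] theorem autE_genB : autE genB = genB := by simp [autE]

/-- The transvection `a ↦ a`, `b ↦ a b`. -/
def autT : MulAut F2 :=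
  MonoidHom.toMulEquiv (endo genA (genA * genB)) (endo genA (genA⁻¹ * genB))
    (by ext i; fin_cases i <;> simp [endo, genA, genB])
    (by ext i; fin_cases i <;> simp [endo, genA, genB])

@[simp] theorem autT_genA : autT genA = genA := by
  rw [autT, MonoidHom.toMulEquiv_apply, endo_genA]
@[simp] theorem autT_genB : autT genB = genA * genB := by
  rw [autT, MonoidHom.toMulEquiv_apply, endo_genB]

theorem autP_mul_self : autP * autP = 1 := aut_ext (by simp) (by simp)

theorem autE_mul_self : autE * autE = 1 := aut_ext (by simp) (by simp)

/-- The group of inner automorphisms. -/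
abbrev Inn : Subgroup (MulAut F2) := (MulAut.conj (G := F2)).range

theorem mul_conj {G : Type*} [Group G] (φ : MulAut G) (u : G) :
    φ * MulAut.conj u = MulAut.conj (φ u) * φ := by
  ext w
  simp

instance : Inn.Normal := by
  constructor
  rintro _ ⟨u, rfl⟩ φ
  exact ⟨φ u, by rw [mul_conj, mul_inv_cancel_right]⟩

/-- The outer automorphism group. -/
abbrev Out : Type := MulAut F2 ⧸ Inn

/-- The class of an automorphism in the outer automorphism group. -/
abbrev toOut : MulAut F2 →* Out := QuotientGroup.mk' Inn

theorem toOut_conj (u : F2) : toOut (MulAut.conj u) = 1 :=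
  (QuotientGroup.eq_one_iff _).2 ⟨u, rfl⟩

theorem toOut_eq_one {φ : MulAut F2} (h : toOut φ = 1) : ∃ u, φ = MulAut.conj u := by
  obtain ⟨u, hu⟩ := (QuotientGroup.eq_one_iff φ).1 h
  exact ⟨u, hu.symm⟩

/-- The automorphisms generated, modulo inner ones, by the swap, the reflection and the
transvection. -/
def elementary : Subgroup (MulAut F2) :=
  (Subgroup.closure {toOut autP, toOut autE, toOut autT}).comap toOut

theorem autP_mem : autP ∈ elementary := Subgroup.subset_closure (by simp)
theorem autE_mem : autE ∈ elementary := Subgroup.subset_closure (by simp)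
theorem autT_mem : autT ∈ elementary := Subgroup.subset_closure (by simp)

theorem conj_mem (u : F2) : MulAut.conj u ∈ elementary := by
  rw [elementary, Subgroup.mem_comap, toOut_conj]
  exact one_mem _

theorem mk_zero_true : mk [((0 : Fin 2), true)] = genA := rfl
theorem mk_one_true : mk [((1 : Fin 2), true)] = genB := rfl
theorem mk_zero_false : mk [((0 : Fin 2), false)] = genA⁻¹ := rfl
theorem mk_one_false : mk [((1 : Fin 2), false)] = genB⁻¹ := rfl

theorem exists_signed_permutation {l m : Fin 2 × Bool} (h : l.1 ≠ m.1) :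
    ∃ d ∈ elementary, d genA = mk [m] ∧ d genB = mk [l] := by
  have hP := autP_mem
  have hE := autE_mem
  have hPEP := mul_mem (mul_mem hP hE) hP
  obtain ⟨i, s⟩ := l
  obtain ⟨j, t⟩ := m
  fin_cases i <;> fin_cases j <;> simp at h <;> cases s <;> cases t <;>
    simp only [Fin.zero_eta, Fin.mk_one, mk_zero_true, mk_one_true, mk_zero_false, mk_one_false]
  · exact ⟨_, mul_mem (mul_mem hPEP hE) hP, by simp, by simp⟩
  · exact ⟨_, mul_mem hE hP, by simp, by simp⟩
  · exact ⟨_, mul_mem hPEP hP, by simp, by simp⟩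
  · exact ⟨_, hP, by simp, by simp⟩
  · exact ⟨_, mul_mem hPEP hE, by simp, by simp⟩
  · exact ⟨_, hPEP, by simp, by simp⟩
  · exact ⟨_, hE, by simp, by simp⟩
  · exact ⟨_, one_mem _, by simp, by simp⟩

theorem exists_transvection {l m : Fin 2 × Bool} (h : l.1 ≠ m.1) :
    ∃ t ∈ elementary, t (mk [m]) = mk [m] ∧ t (mk [l]) = mk [l] * mk [m] := by
  obtain ⟨d, hd, hm, hl⟩ := exists_signed_permutation h
  -- The middle factor is `a ↦ a`, `b ↦ b a`; `d` carries it to the letters `m` and `l`.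
  refine ⟨d * (MulAut.conj genA⁻¹ * autT) * d⁻¹,
    mul_mem (mul_mem hd (mul_mem (conj_mem _) autT_mem)) (inv_mem hd), ?_, ?_⟩
  · rw [← hm]
    simp
  · rw [← hm, ← hl]
    simp

/-- The total length of the images of the two generators. -/
def size (ψ : MulAut F2) : ℕ := (ψ genA).norm + (ψ genB).norm

theorem norm_map_flip (ψ : MulAut F2) (l : Fin 2 × Bool) :
    (ψ (mk [flipLetter l])).norm = (ψ (mk [l])).norm := by
  rw [← inv_mk_singleton, map_inv, FreeGroup.norm_inv_eq]

theorem size_eq (ψ : MulAut F2) {l m : Fin 2 × Bool} (h : l.1 ≠ m.1) :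
    size ψ = (ψ (mk [l])).norm + (ψ (mk [m])).norm := by
  obtain ⟨i, s⟩ := l
  obtain ⟨j, t⟩ := m
  fin_cases i <;> fin_cases j <;> simp at h <;> cases s <;> cases t <;>
    simp [mk_zero_true, mk_one_true, mk_zero_false, mk_one_false, size, add_comm]

/-- No elementary automorphism decreases the size. -/
def IsMinimal (ψ : MulAut F2) : Prop := ∀ k ∈ elementary, size ψ ≤ size (ψ * k)

namespace IsMinimal

variable {ψ : MulAut F2}

theorem norm_le_norm_mul (hψ : IsMinimal ψ) {l m : Fin 2 × Bool} (h : l.1 ≠ m.1) :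
    (ψ (mk [l])).norm ≤ (ψ (mk [l]) * ψ (mk [m])).norm := by
  obtain ⟨t, ht, hm, hl⟩ := exists_transvection h
  have := hψ t ht
  rw [size_eq ψ h, size_eq _ h, MulAut.mul_apply, MulAut.mul_apply, hm, hl, map_mul] at this
  omega

/-- Since no transvection shortens, a letter's image cancels at most half of a neighbour from the
other generator. -/
theorem two_mul_gp_le_left (hψ : IsMinimal ψ) {l m : Fin 2 × Bool} (h : l.1 ≠ m.1) :
    2 * gp (ψ (mk [l]))⁻¹ (ψ (mk [m])) ≤ (ψ (mk [m])).norm := by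
  have h1 := hψ.norm_le_norm_mul h
  have h2 := norm_mul (ψ (mk [l])) (ψ (mk [m]))
  omega

theorem two_mul_gp_le_right (hψ : IsMinimal ψ) {l m : Fin 2 × Bool} (h : l.1 ≠ m.1) :
    2 * gp (ψ (mk [l]))⁻¹ (ψ (mk [m])) ≤ (ψ (mk [l])).norm := by
  have h1 := hψ.two_mul_gp_le_left (l := flipLetter m) (m := flipLetter l) h.symm
  rwa [norm_map_flip, ← inv_mk_singleton, ← inv_mk_singleton, map_inv, map_inv, inv_inv,
    gp_comm] at h1

/-- Two letters cannot cancel against both halves of a third one. -/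
theorem gp_ne_of_eq (hψ : IsMinimal ψ) {l m : Fin 2 × Bool} (h : l.1 ≠ m.1) {k : ℕ}
    (hk : 0 < k) (hy : (ψ (mk [m])).norm = 2 * k)
    (h1 : k ≤ gp (ψ (mk [l]))⁻¹ (ψ (mk [m]))) (h2 : k ≤ gp (ψ (mk [m]))⁻¹ (ψ (mk [l]))) :
    False := by
  have hxn := hψ.two_mul_gp_le_right h
  obtain ⟨t, ht, hm, hl⟩ := exists_transvection h
  set x := ψ (mk [l]) with hx
  set y := ψ (mk [m]) with hy'
  obtain ⟨q, r', hqr, hq, hr'⟩ := exists_prefix y (k := k) (by omega)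
  obtain ⟨r, rfl⟩ : ∃ r, r' = r⁻¹ := ⟨r'⁻¹, by simp⟩
  rw [FreeGroup.norm_inv_eq] at hr'
  have hr : r.norm = k := by omega
  -- Here `y = q r⁻¹` with halves of length `k`, while `x` starts with `r` and ends with `q⁻¹`. The
  -- transvected pair conjugated by `r⁻¹` is `r⁻¹ x q`, `r⁻¹ q`, whose total length is smaller by at
  -- least `2 * k`.
  have key := hψ (MulAut.conj (ψ⁻¹ r⁻¹) * t) (mul_mem (conj_mem _) ht)
  rw [← mul_assoc, mul_conj, MulAut.apply_inv_self, size_eq ψ h, size_eq _ h] at key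
  simp only [MulAut.mul_apply, hm, hl, map_mul, ← hx, ← hy', MulAut.conj_apply, inv_inv] at key
  have e1 : r⁻¹ * x * r * (r⁻¹ * y * r) = r⁻¹ * x * q := by rw [hqr]; group
  have e2 : r⁻¹ * y * r = r⁻¹ * q := by rw [hqr]; group
  rw [e1, e2] at key
  have e3 : (r⁻¹ * q).norm ≤ k + k := by
    have := FreeGroup.norm_mul_le r⁻¹ q
    rwa [FreeGroup.norm_inv_eq, hr, hq] at this
  have g1 : k ≤ gp r y⁻¹ := by
    have e : r⁻¹ * y⁻¹ = q⁻¹ := by rw [hqr]; group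
    have := norm_inv_mul r y⁻¹
    rw [e, FreeGroup.norm_inv_eq, FreeGroup.norm_inv_eq] at this
    omega
  have g2 : k ≤ gp r x := le_gp_trans g1 h2
  have n1 := norm_inv_mul r x
  have g2' := gp_le_left r x
  have g3 : k ≤ gp y q := by
    have e : q⁻¹ * y = r⁻¹ := by rw [hqr]; group
    have := norm_inv_mul q y
    rw [e, FreeGroup.norm_inv_eq] at this
    rw [gp_comm]
    omega
  have g4 : k ≤ gp x⁻¹ q := le_gp_trans h1 g3
  have e5 : (x⁻¹ * r).norm = (r⁻¹ * x).norm := by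
    rw [← FreeGroup.norm_inv_eq]
    simp
  have g5 : k ≤ gp (x⁻¹ * r) x⁻¹ := by
    have e : (x⁻¹ * r)⁻¹ * x⁻¹ = r⁻¹ := by group
    have := norm_inv_mul (x⁻¹ * r) x⁻¹
    rw [e, FreeGroup.norm_inv_eq, FreeGroup.norm_inv_eq] at this
    omega
  have g6 : k ≤ gp (x⁻¹ * r) q := le_gp_trans g5 g4
  have n2 := norm_inv_mul (x⁻¹ * r) q
  rw [show (x⁻¹ * r)⁻¹ * q = r⁻¹ * x * q by group] at n2
  omega

/-- Failure would need both sides to cancel exactly half. A neighbour equal to `m` cancels strictly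
less; `n = l` contradicts `gp_ne_of_eq`; and `n = l⁻¹` would make the images of `m` and `m⁻¹` share
half their length. -/
theorem gp_add_gp_lt (hψ : IsMinimal ψ) {l m n : Fin 2 × Bool} (hlm : m ≠ flipLetter l)
    (hmn : n ≠ flipLetter m) :
    gp (ψ (mk [l]))⁻¹ (ψ (mk [m])) + gp (ψ (mk [m]))⁻¹ (ψ (mk [n])) < (ψ (mk [m])).norm := by
  have eq_of : ∀ {l m : Fin 2 × Bool}, m ≠ flipLetter l → l.1 = m.1 → l = m := by
    intro l m h1 h2
    refine Prod.ext h2 ?_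
    by_contra h3
    apply h1
    refine Prod.ext h2.symm ?_
    revert h3
    simp only [flipLetter]
    cases l.2 <;> cases m.2 <;> simp
  have hm1 : ψ (mk [m]) ≠ 1 := by
    rw [Ne, map_eq_one_iff ψ ψ.injective, ← FreeGroup.toWord_eq_nil_iff]
    simp [FreeGroup.toWord_mk]
  have hpos := two_mul_gp_inv_self_lt hm1
  by_contra! hle
  have b1 : 2 * gp (ψ (mk [l]))⁻¹ (ψ (mk [m])) ≤ (ψ (mk [m])).norm := by
    by_cases h : l.1 = m.1
    · obtain rfl := eq_of hlm h
      exact hpos.le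
    · exact hψ.two_mul_gp_le_left h
  have b2 : 2 * gp (ψ (mk [m]))⁻¹ (ψ (mk [n])) ≤ (ψ (mk [m])).norm := by
    by_cases h : m.1 = n.1
    · obtain rfl := eq_of hmn h
      exact hpos.le
    · exact hψ.two_mul_gp_le_right h
  by_cases h : l.1 = m.1
  · obtain rfl := eq_of hlm h
    omega
  by_cases h' : m.1 = n.1
  · obtain rfl := eq_of hmn h'
    omega
  have hnl : l.1 = n.1 := by omega
  by_cases hf : n = flipLetter l
  · subst hf
    rw [← inv_mk_singleton, map_inv] at hle b2
    have := le_gp_trans (g := (ψ (mk [m]))⁻¹) (h := (ψ (mk [l]))⁻¹) (k := ψ (mk [m]))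
      (n := gp (ψ (mk [l]))⁻¹ (ψ (mk [m]))) (by omega) le_rfl
    omega
  · obtain rfl := eq_of hf hnl
    exact hψ.gp_ne_of_eq h (k := gp (ψ (mk [l]))⁻¹ (ψ (mk [m]))) (by omega) (by omega) le_rfl
      (by omega)

theorem norm_le_norm_map (hψ : IsMinimal ψ) (w : F2) : w.norm ≤ (ψ w).norm := by
  by_cases hw : w = 1
  · simp [hw]
  obtain ⟨x, L, hx⟩ := List.exists_cons_of_ne_nil (mt FreeGroup.toWord_eq_nil_iff.1 hw)
  have hne : ∀ l : Fin 2 × Bool, l ≠ flipLetter l := by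
    intro l h
    have := congrArg Prod.snd h
    revert this
    simp only [flipLetter]
    cases l.2 <;> simp
  have hred : (x :: L).IsChain fun l m : Fin 2 × Bool => m ≠ flipLetter l := by
    rw [← hx]
    refine List.IsChain.imp ?_ (FreeGroup.isReduced_toWord (x := w))
    rintro l m h rfl
    exact hne l (Prod.ext rfl (h rfl))
  have key := (norm_prod_of_isChain (fun l => ψ (mk [l])) (fun l m => m ≠ flipLetter l)
    (fun l m n h1 h2 => hψ.gp_add_gp_lt h1 h2) (fun l => ⟨l, hne l⟩) L x hred x (hne x)).2
  have e : ((x :: L).map fun l => ψ (mk [l])).prod = ψ w := by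
    rw [← FreeGroup.mk_toWord (x := w), hx]
    generalize x :: L = M
    induction M with
    | nil => simp [← FreeGroup.one_eq_mk]
    | cons y M ih =>
      rw [List.map_cons, List.prod_cons, ih, ← map_mul, FreeGroup.mul_mk, List.singleton_append]
  rw [e] at key
  have : w.norm = L.length + 1 := by rw [FreeGroup.norm, hx, List.length_cons]
  omega

/-- A minimal `ψ` never shortens words, so preimages of the generators have length one and `ψ⁻¹` is
a signed permutation. -/
theorem mem_elementary (hψ : IsMinimal ψ) : ψ ∈ elementary := by
  have hl : ∀ i, ∃ l, mk [l] = ψ⁻¹ (of i) := by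
    intro i
    have h1 := hψ.norm_le_norm_map (ψ⁻¹ (of i))
    rw [MulAut.apply_inv_self, FreeGroup.norm_of] at h1
    have h2 : (ψ⁻¹ (of i)).norm ≠ 0 := by
      rw [Ne, FreeGroup.norm_eq_zero, map_eq_one_iff _ (MulEquiv.injective _)]
      exact FreeGroup.of_ne_one i
    obtain ⟨l, hl⟩ := List.length_eq_one_iff.1 (show (ψ⁻¹ (of i)).toWord.length = 1 from
      le_antisymm h1 (Nat.one_le_iff_ne_zero.2 h2))
    exact ⟨l, by rw [← hl, FreeGroup.mk_toWord]⟩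
  obtain ⟨m, hm⟩ := hl 0
  obtain ⟨l, hl⟩ := hl 1
  have hlm : l.1 ≠ m.1 := by
    intro h
    by_cases h2 : l.2 = m.2
    · rw [Prod.ext h h2, hm] at hl
      exact absurd (FreeGroup.of_injective ((MulEquiv.injective _) hl)) (by simp)
    · have : l = flipLetter m := by
        refine Prod.ext h ?_
        revert h2
        simp only [flipLetter]
        cases l.2 <;> cases m.2 <;> simp
      rw [this, ← inv_mk_singleton, hm, ← map_inv] at hl
      have h3 := congrArg toWord ((MulEquiv.injective _) hl)
      simp [FreeGroup.invRev] at h3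
  obtain ⟨d, hd, h0, h1⟩ := exists_signed_permutation hlm
  have : ψ⁻¹ = d := aut_ext (by rw [h0, hm]; rfl) (by rw [h1, hl]; rfl)
  rw [← inv_mem_iff, this]
  exact hd

end IsMinimal

/-- The Nielsen theorem in rank two: elementary automorphisms are all automorphisms. -/
theorem elementary_eq_top : elementary = ⊤ := by
  rw [eq_top_iff]
  intro φ _
  induction hn : size φ using Nat.strong_induction_on generalizing φ with
  | _ n ih =>
    subst hn
    by_cases hmin : IsMinimal φ
    · exact hmin.mem_elementary
    · simp only [IsMinimal, not_forall, not_le] at hmin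
      obtain ⟨k, hk, hlt⟩ := hmin
      exact (mul_mem_cancel_right hk).1 (ih _ hlt (Subgroup.mem_top _) rfl)

/-! ### The action on the abelianization. -/

section Abelianization

/-- The exponent sum of a generator, as a homomorphism. -/
def expHom (i : Fin 2) : F2 →* Multiplicative ℤ :=
  FreeGroup.lift fun j => Multiplicative.ofAdd (if i = j then 1 else 0)

/-- The exponent sum of a generator. -/
def ex (i : Fin 2) (w : F2) : ℤ := Multiplicative.toAdd (expHom i w)

@[simp] theorem ex_mul (i : Fin 2) (u v : F2) : ex i (u * v) = ex i u + ex i v := by simp [ex]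
@[simp] theorem ex_inv (i : Fin 2) (u : F2) : ex i u⁻¹ = -ex i u := by simp [ex]
@[simp] theorem ex_one (i : Fin 2) : ex i 1 = 0 := by simp [ex]
theorem ex_of (i j : Fin 2) : ex i (of j) = if i = j then 1 else 0 := by simp [ex, expHom]
@[simp] theorem ex_genA (i : Fin 2) : ex i genA = if i = 0 then 1 else 0 := ex_of i 0
@[simp] theorem ex_genB (i : Fin 2) : ex i genB = if i = 1 then 1 else 0 := ex_of i 1

theorem ex_map (φ : F2 →* F2) (i : Fin 2) (w : F2) :
    ex i (φ w) = ex i (φ genA) * ex 0 w + ex i (φ genB) * ex 1 w := by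
  induction w using FreeGroup.induction_on with
  | C1 => simp
  | of j => fin_cases j <;> simp [ex_of, genA, genB]
  | inv_of j h => simp only [map_inv, ex_inv, h]; ring
  | mul u v hu hv => simp only [map_mul, ex_mul, hu, hv]; ring

/-- The action of an automorphism on the abelianization. -/
def toMat : MulAut F2 →* Matrix (Fin 2) (Fin 2) ℤ where
  toFun φ := !![ex 0 (φ genA), ex 0 (φ genB); ex 1 (φ genA), ex 1 (φ genB)]
  map_one' := by simp [Matrix.one_fin_two]
  map_mul' φ ψ := by
    have h := fun i w => ex_map φ.toMonoidHom i w
    simp only [MulEquiv.toMonoidHom_eq_coe, MonoidHom.coe_coe] at h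
    simp only [MulAut.mul_apply, Matrix.mul_fin_two]
    rw [h 0 (ψ genA), h 0 (ψ genB), h 1 (ψ genA), h 1 (ψ genB)]

theorem toMat_apply (φ : MulAut F2) :
    toMat φ = !![ex 0 (φ genA), ex 0 (φ genB); ex 1 (φ genA), ex 1 (φ genB)] := rfl

theorem ex_apply (φ : MulAut F2) (i : Fin 2) (w : F2) :
    ex i (φ w) = toMat φ i 0 * ex 0 w + toMat φ i 1 * ex 1 w := by
  have := ex_map φ.toMonoidHom i w
  simp only [MulEquiv.toMonoidHom_eq_coe, MonoidHom.coe_coe] at this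
  rw [this]
  fin_cases i <;> simp [toMat_apply]

theorem toMat_conj (u : F2) : toMat (MulAut.conj u) = 1 := by
  simp [toMat_apply, Matrix.one_fin_two]

theorem toMat_autP : toMat autP = !![0, 1; 1, 0] := by simp [toMat_apply]
theorem toMat_autE : toMat autE = !![-1, 0; 0, 1] := by simp [toMat_apply]
theorem toMat_autT : toMat autT = !![1, 1; 0, 1] := by simp [toMat_apply]

/-- The action of an outer automorphism on the abelianization. -/
def outMat : Out →* Matrix (Fin 2) (Fin 2) ℤ :=
  QuotientGroup.lift Inn toMat (by rintro _ ⟨u, rfl⟩; exact toMat_conj u)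

theorem outMat_toOut (φ : MulAut F2) : outMat (toOut φ) = toMat φ := rfl

end Abelianization

/-! ### A normal form from the relations of GL₂(ℤ). -/

section NormalForm

variable {O : Type*} [Group O] {p e t : O}

/-- Conjugation by `p` exchanges the two transvections and conjugation by `e` inverts both, so they
can be moved past the dihedral subgroup. -/
theorem exists_mul_eq_of_mem_closure (hp : p * p = 1) (he : e * e = 1) (het : e * t * e = t⁻¹)
    (heq : e * (p * t * p) * e = (p * t * p)⁻¹) {d : O} (hd : d ∈ Subgroup.closure {p, e}) {s : O}
    (hs : s = t ∨ s = t⁻¹ ∨ s = p * t * p ∨ s = (p * t * p)⁻¹) :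
    ∃ s', (s' = t ∨ s' = t⁻¹ ∨ s' = p * t * p ∨ s' = (p * t * p)⁻¹) ∧ s * d = d * s' := by
  have hp' : p⁻¹ = p := inv_eq_of_mul_eq_one_left hp
  have he' : e⁻¹ = e := inv_eq_of_mul_eq_one_left he
  have step : ∀ x ∈ ({p, e} : Set O), ∀ s,
      (s = t ∨ s = t⁻¹ ∨ s = p * t * p ∨ s = (p * t * p)⁻¹) →
      ∃ s', (s' = t ∨ s' = t⁻¹ ∨ s' = p * t * p ∨ s' = (p * t * p)⁻¹) ∧ s * x = x * s' := by
    have ppx : ∀ x : O, p * (p * x) = x := fun x => by rw [← mul_assoc, hp, one_mul]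
    have eex : ∀ x : O, e * (e * x) = x := fun x => by rw [← mul_assoc, he, one_mul]
    have hte : t * e = e * t⁻¹ := by rw [← het, mul_assoc, eex]
    have hte' : t⁻¹ * e = e * t := by rw [← het, mul_assoc, he, mul_one]
    have hqe : p * t * p * e = e * (p * t * p)⁻¹ := by rw [← heq, mul_assoc e, eex]
    have hqe' : (p * t * p)⁻¹ * e = e * (p * t * p) := by rw [← heq, mul_assoc, he, mul_one]
    have htp : t * p = p * (p * t * p) := by rw [mul_assoc, ppx]
    have htp' : t⁻¹ * p = p * (p * t * p)⁻¹ := by simp [mul_assoc, hp', ppx]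
    have hqp : p * t * p * p = p * t := by rw [mul_assoc, hp, mul_one]
    have hqp' : (p * t * p)⁻¹ * p = p * t⁻¹ := by simp [mul_assoc, hp', hp]
    rintro x (rfl | rfl) s (rfl | rfl | rfl | rfl)
    · exact ⟨_, by simp, htp⟩
    · exact ⟨_, by simp, htp'⟩
    · exact ⟨t, by simp, hqp⟩
    · exact ⟨t⁻¹, by simp, hqp'⟩
    · exact ⟨_, by simp, hte⟩
    · exact ⟨_, by simp, hte'⟩
    · exact ⟨_, by simp, hqe⟩
    · exact ⟨_, by simp, hqe'⟩
  induction hd using Subgroup.closure_induction_left generalizing s with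
  | one => exact ⟨s, hs, by simp⟩
  | mul_left x hx y hy ih =>
    obtain ⟨s₁, hs₁, e₁⟩ := step x hx s hs
    obtain ⟨s₂, hs₂, e₂⟩ := ih hs₁
    exact ⟨s₂, hs₂, by rw [← mul_assoc, e₁, mul_assoc, e₂, mul_assoc]⟩
  | inv_mul_cancel x hx y hy ih =>
    have hx' : x⁻¹ = x := by rcases hx with rfl | rfl <;> assumption
    rw [hx']
    obtain ⟨s₁, hs₁, e₁⟩ := step x hx s hs
    obtain ⟨s₂, hs₂, e₂⟩ := ih hs₁
    exact ⟨s₂, hs₂, by rw [← mul_assoc, e₁, mul_assoc, e₂, mul_assoc]⟩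

/-- A normal form for groups with the relations of `GL₂(ℤ)`: a positive word in two transvections
between two elements of the dihedral subgroup. -/
theorem exists_dihedral_positive_dihedral (hp : p * p = 1) (he : e * e = 1)
    (het : e * t * e = t⁻¹) (heq : e * (p * t * p) * e = (p * t * p)⁻¹)
    (hst : t⁻¹ * (p * t * p) = e * p * t) {g : O} (hg : g ∈ Subgroup.closure {p, e, t}) :
    ∃ d ∈ Subgroup.closure {p, e}, ∃ n ∈ Submonoid.closure {t, p * t * p},
      ∃ d' ∈ Subgroup.closure {p, e}, g = d * n * d' := by
  have hp' : p⁻¹ = p := inv_eq_of_mul_eq_one_left hp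
  have he' : e⁻¹ = e := inv_eq_of_mul_eq_one_left he
  have pD : p ∈ Subgroup.closure {p, e} := Subgroup.subset_closure (by simp)
  have eD : e ∈ Subgroup.closure {p, e} := Subgroup.subset_closure (by simp)
  have tN : t ∈ Submonoid.closure {t, p * t * p} := Submonoid.subset_closure (by simp)
  have qN : p * t * p ∈ Submonoid.closure {t, p * t * p} := Submonoid.subset_closure (by simp)
  have hst' : (p * t * p)⁻¹ * t = p * e * (p * t * p) := by
    have : (p * t * p)⁻¹ * t = p * (t⁻¹ * (p * t * p)) * p := by
      simp only [mul_inv_rev, hp', mul_assoc, hp, mul_one]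
    rw [this, hst]
    simp only [mul_assoc]
  -- A negative transvection cancels against an equal first factor; against the other one, `hst` or
  -- `hst'` trades the two for a dihedral element and one positive factor.
  have pos : ∀ n ∈ Submonoid.closure {t, p * t * p}, ∀ s,
      (s = t ∨ s = t⁻¹ ∨ s = p * t * p ∨ s = (p * t * p)⁻¹) →
      ∃ d ∈ Subgroup.closure {p, e}, ∃ n' ∈ Submonoid.closure {t, p * t * p},
        ∃ d' ∈ Subgroup.closure {p, e}, s * n = d * n' * d' := by
    intro n hn
    induction hn using Submonoid.closure_induction_left with
    | one =>
      rintro s (rfl | rfl | rfl | rfl)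
      · exact ⟨1, one_mem _, _, tN, 1, one_mem _, by simp⟩
      · exact ⟨e, eD, _, tN, e, eD, by rw [het, mul_one]⟩
      · exact ⟨1, one_mem _, _, qN, 1, one_mem _, by simp⟩
      · exact ⟨e, eD, _, qN, e, eD, by rw [heq, mul_one]⟩
    | mul_left x hx y hy ih =>
      have hxN := Submonoid.subset_closure hx
      have hxy := mul_mem hxN hy
      rintro s (rfl | rfl | rfl | rfl)
      · exact ⟨1, one_mem _, _, mul_mem tN hxy, 1, one_mem _, by simp⟩
      · rcases hx with rfl | rfl
        · exact ⟨1, one_mem _, _, hy, 1, one_mem _, by simp⟩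
        · exact ⟨e * p, mul_mem eD pD, _, mul_mem tN hy, 1, one_mem _, by
            rw [← mul_assoc, hst, mul_one, mul_assoc]⟩
      · exact ⟨1, one_mem _, _, mul_mem qN hxy, 1, one_mem _, by simp⟩
      · rcases hx with rfl | rfl
        · exact ⟨p * e, mul_mem pD eD, _, mul_mem qN hy, 1, one_mem _, by
            rw [← mul_assoc, hst', mul_one, mul_assoc]⟩
        · exact ⟨1, one_mem _, _, hy, 1, one_mem _, by
            rw [inv_mul_cancel_left, one_mul, mul_one]⟩
  have left_mul : ∀ s, (s = t ∨ s = t⁻¹ ∨ s = p * t * p ∨ s = (p * t * p)⁻¹) → ∀ y,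
      (∃ d ∈ Subgroup.closure {p, e}, ∃ n ∈ Submonoid.closure {t, p * t * p},
        ∃ d' ∈ Subgroup.closure {p, e}, y = d * n * d') →
      ∃ d ∈ Subgroup.closure {p, e}, ∃ n ∈ Submonoid.closure {t, p * t * p},
        ∃ d' ∈ Subgroup.closure {p, e}, s * y = d * n * d' := by
    rintro s hs _ ⟨d, hd, n, hn, d', hd', rfl⟩
    obtain ⟨s', hs', e₁⟩ := exists_mul_eq_of_mem_closure hp he het heq hd hs
    obtain ⟨d₁, hd₁, n₁, hn₁, d₂, hd₂, e₂⟩ := pos n hn s' hs'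
    refine ⟨d * d₁, mul_mem hd hd₁, n₁, hn₁, d₂ * d', mul_mem hd₂ hd', ?_⟩
    calc s * (d * n * d') = s * d * n * d' := by simp only [mul_assoc]
      _ = d * (s' * n) * d' := by rw [e₁]; simp only [mul_assoc]
      _ = d * d₁ * n₁ * (d₂ * d') := by rw [e₂]; simp only [mul_assoc]
  induction hg using Subgroup.closure_induction_left with
  | one => exact ⟨1, one_mem _, 1, one_mem _, 1, one_mem _, by simp⟩
  | mul_left x hx y hy ih =>
    rcases hx with rfl | rfl | rfl
    · obtain ⟨d, hd, n, hn, d', hd', rfl⟩ := ih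
      exact ⟨_, mul_mem pD hd, n, hn, d', hd', by simp only [mul_assoc]⟩
    · obtain ⟨d, hd, n, hn, d', hd', rfl⟩ := ih
      exact ⟨_, mul_mem eD hd, n, hn, d', hd', by simp only [mul_assoc]⟩
    · exact left_mul _ (by simp) y ih
  | inv_mul_cancel x hx y hy ih =>
    rcases hx with rfl | rfl | rfl
    · obtain ⟨d, hd, n, hn, d', hd', rfl⟩ := ih
      exact ⟨_, mul_mem pD hd, n, hn, d', hd', by rw [hp']; simp only [mul_assoc]⟩
    · obtain ⟨d, hd, n, hn, d', hd', rfl⟩ := ih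
      exact ⟨_, mul_mem eD hd, n, hn, d', hd', by rw [he']; simp only [mul_assoc]⟩
    · exact left_mul _ (by simp) y ih

end NormalForm

/-! ### The kernel on the abelianization is inner. -/

section Kernel

/-- Signed permutations of the two generators. -/
def IsSignedPerm (φ : MulAut F2) : Prop :=
  ∃ l m : Fin 2 × Bool, l.1 ≠ m.1 ∧ φ genA = mk [m] ∧ φ genB = mk [l]

theorem autP_mk (l : Fin 2 × Bool) : autP (mk [l]) = mk [(1 - l.1, l.2)] := by
  obtain ⟨i, s⟩ := l
  fin_cases i <;> cases s <;>
    simp [mk_zero_true, mk_one_true, mk_zero_false, mk_one_false]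

theorem autE_mk (l : Fin 2 × Bool) : autE (mk [l]) = mk [(l.1, if l.1 = 0 then !l.2 else l.2)] := by
  obtain ⟨i, s⟩ := l
  fin_cases i <;> cases s <;>
    simp [mk_zero_true, mk_one_true, mk_zero_false, mk_one_false]

theorem IsSignedPerm.autP_mul {φ : MulAut F2} (h : IsSignedPerm φ) : IsSignedPerm (autP * φ) := by
  obtain ⟨l, m, hlm, ha, hb⟩ := h
  refine ⟨(1 - l.1, l.2), (1 - m.1, m.2), by simpa using hlm, ?_, ?_⟩
  · rw [MulAut.mul_apply, ha, autP_mk]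
  · rw [MulAut.mul_apply, hb, autP_mk]

theorem IsSignedPerm.autE_mul {φ : MulAut F2} (h : IsSignedPerm φ) : IsSignedPerm (autE * φ) := by
  obtain ⟨l, m, hlm, ha, hb⟩ := h
  refine ⟨_, _, ?_, by rw [MulAut.mul_apply, ha, autE_mk], by rw [MulAut.mul_apply, hb, autE_mk]⟩
  exact hlm

theorem exists_isSignedPerm {d : Out} (hd : d ∈ Subgroup.closure {toOut autP, toOut autE}) :
    ∃ φ, IsSignedPerm φ ∧ toOut φ = d := by
  have hp : (toOut autP)⁻¹ = toOut autP :=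
    inv_eq_of_mul_eq_one_left (by rw [← map_mul, autP_mul_self, map_one])
  have he : (toOut autE)⁻¹ = toOut autE :=
    inv_eq_of_mul_eq_one_left (by rw [← map_mul, autE_mul_self, map_one])
  have step : ∀ x ∈ ({toOut autP, toOut autE} : Set Out), ∀ y,
      (∃ φ, IsSignedPerm φ ∧ toOut φ = y) → ∃ φ, IsSignedPerm φ ∧ toOut φ = x * y := by
    rintro x (rfl | rfl) _ ⟨φ, hφ, rfl⟩
    · exact ⟨_, hφ.autP_mul, map_mul _ _ _⟩
    · exact ⟨_, hφ.autE_mul, map_mul _ _ _⟩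
  induction hd using Subgroup.closure_induction_left with
  | one => exact ⟨1, ⟨(1, true), (0, true), by simp, rfl, rfl⟩, map_one _⟩
  | mul_left x hx y hy ih => exact step x hx y ih
  | inv_mul_cancel x hx y hy ih =>
    have : x⁻¹ = x := by rcases hx with rfl | rfl <;> assumption
    rw [this]
    exact step x hx y ih

/-- The bound 2 on the entry sum separates signed permutations from the positive words of
`outMat_positive`, whose sum is at least 3. -/
theorem IsSignedPerm.toMat_cases {φ : MulAut F2} (h : IsSignedPerm φ) :
    (toMat φ 0 0 + toMat φ 0 1 + toMat φ 1 0 + toMat φ 1 1 ≤ 2) ∧ (toMat φ = 1 → φ = 1) := by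
  obtain ⟨⟨i, s⟩, ⟨j, t⟩, hlm, ha, hb⟩ := h
  fin_cases i <;> fin_cases j <;> simp at hlm <;> cases s <;> cases t <;>
    simp only [Fin.zero_eta, Fin.mk_one, mk_zero_true, mk_one_true, mk_zero_false,
      mk_one_false] at ha hb <;>
    refine ⟨by simp [toMat_apply, ha, hb], fun h1 => ?_⟩ <;>
    first
    | (exfalso
       simp [toMat_apply, ha, hb, ← Matrix.ext_iff, Matrix.one_apply] at h1
       done)
    | exact aut_ext ha hb

/-- Each factor adds one row to the other. The entry sum rises from 2 to 3 at the identity and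
cannot drop afterwards, the entries being nonnegative. -/
theorem outMat_positive {n : Out}
    (hn : n ∈ Submonoid.closure {toOut autT, toOut autP * toOut autT * toOut autP}) :
    n = 1 ∨ (∀ i j, 0 ≤ outMat n i j) ∧
      3 ≤ outMat n 0 0 + outMat n 0 1 + outMat n 1 0 + outMat n 1 1 := by
  induction hn using Submonoid.closure_induction_left with
  | one => exact Or.inl rfl
  | mul_left x hx y hy ih =>
    right
    have hy' : (∀ i j, 0 ≤ outMat y i j) ∧ (y = 1 ∨
        3 ≤ outMat y 0 0 + outMat y 0 1 + outMat y 1 0 + outMat y 1 1) := by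
      rcases ih with rfl | h
      · refine ⟨fun i j => ?_, Or.inl rfl⟩
        rw [map_one]
        fin_cases i <;> fin_cases j <;> simp
      · exact ⟨h.1, Or.inr h.2⟩
    obtain ⟨hpos, hsum⟩ := hy'
    have h00 := hpos 0 0
    have h01 := hpos 0 1
    have h10 := hpos 1 0
    have h11 := hpos 1 1
    have hq : toMat autP * toMat autT * toMat autP = !![1, 0; 1, 1] := by
      rw [toMat_autP, toMat_autT]; simp
    have hsum' : y = 1 → outMat y 0 0 = 1 ∧ outMat y 0 1 = 0 ∧ outMat y 1 0 = 0 ∧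
        outMat y 1 1 = 1 := by
      rintro rfl; simp [map_one]
    rcases hx with rfl | rfl
    · rw [map_mul, outMat_toOut, toMat_autT]
      refine ⟨fun i j => ?_, ?_⟩
      · fin_cases i <;> fin_cases j <;> simp [Matrix.mul_apply, Fin.sum_univ_two] <;> omega
      · simp only [Matrix.mul_apply, Fin.sum_univ_two]
        simp
        rcases hsum with h | h
        · have := hsum' h
          omega
        · omega
    · rw [map_mul, map_mul, map_mul, outMat_toOut, outMat_toOut, hq]
      refine ⟨fun i j => ?_, ?_⟩
      · fin_cases i <;> fin_cases j <;> simp [Matrix.mul_apply, Fin.sum_univ_two] <;> omega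
      · simp only [Matrix.mul_apply, Fin.sum_univ_two]
        simp
        rcases hsum with h | h
        · have := hsum' h
          omega
        · omega

theorem toOut_eq_of_conj {φ ψ : MulAut F2} (u : F2) (h : φ = MulAut.conj u * ψ) :
    toOut φ = toOut ψ := by
  rw [h, map_mul, toOut_conj, one_mul]

/-- An automorphism of `F₂` that acts trivially on the abelianization is inner. -/
theorem exists_conj_of_toMat_eq_one {φ : MulAut F2} (h : toMat φ = 1) :
    ∃ u, φ = MulAut.conj u := by
  apply toOut_eq_one
  have hmem : toOut φ ∈ Subgroup.closure {toOut autP, toOut autE, toOut autT} := by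
    have : φ ∈ elementary := by rw [elementary_eq_top]; trivial
    exact this
  obtain ⟨d, hd, n, hn, d', hd', e⟩ := exists_dihedral_positive_dihedral
    (by rw [← map_mul, autP_mul_self, map_one]) (by rw [← map_mul, autE_mul_self, map_one])
    (by
      rw [← map_mul, ← map_mul, ← map_inv]
      refine congrArg _ (eq_inv_of_mul_eq_one_left (aut_ext ?_ ?_)) <;> simp)
    (by
      refine eq_inv_of_mul_eq_one_left ?_
      simp only [← map_mul]
      refine (toOut_eq_of_conj genB (ψ := 1) (aut_ext ?_ ?_)).trans (map_one _) <;> simp [mul_assoc])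
    (by
      rw [inv_mul_eq_iff_eq_mul]
      simp only [← map_mul]
      refine toOut_eq_of_conj genA⁻¹ (aut_ext ?_ ?_) <;> simp [mul_assoc]) hmem
  -- The positive part has the matrix of a signed permutation, so it is trivial by the entry sums;
  -- what remains is a signed permutation with identity matrix.
  have hdd : outMat (d⁻¹ * d'⁻¹) = outMat n := by
    have e2 : n = d⁻¹ * toOut φ * d'⁻¹ := by rw [e]; group
    rw [e2, map_mul, map_mul, map_mul, outMat_toOut, h, mul_one]
  have hn1 : n = 1 := by
    rcases outMat_positive hn with h1 | ⟨-, h3⟩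
    · exact h1
    · obtain ⟨δ, hδ, hδ'⟩ := exists_isSignedPerm (mul_mem (inv_mem hd) (inv_mem hd'))
      have := hδ.toMat_cases.1
      rw [← outMat_toOut, hδ', hdd] at this
      omega
  rw [hn1, mul_one] at e
  obtain ⟨δ, hδ, hδ'⟩ := exists_isSignedPerm (mul_mem hd hd')
  have h1 : δ = 1 := hδ.toMat_cases.2 (by rw [← outMat_toOut, hδ', ← e, outMat_toOut, h])
  rw [e, ← hδ', h1, map_one]

end Kernel

local notation "Mat" => Matrix (Fin 2) (Fin 2) ℤ

/-! ### Finite-order integer matrices and Gauss reduction. -/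

section Matrices

theorem mul_self_eq (M : Mat) : M * M = M.trace • M - M.det • 1 := by
  ext i j
  fin_cases i <;> fin_cases j <;>
    simp [Matrix.mul_apply, Fin.sum_univ_two, Matrix.trace_fin_two, Matrix.det_fin_two,
      -zsmul_eq_mul, -zsmul_one] <;> ring

/-- By Cayley–Hamilton the coefficients follow `(u, v) ↦ (tr u + v, -u)`, which preserves `|v| <
|u|`. Hence the coefficient of `M` never vanishes, and a trivial power forces `M` to be scalar. -/
theorem exists_pow_eq {M : Mat} (hd : M.det = 1) (ht : 2 ≤ |M.trace|) (k : ℕ) :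
    ∃ u v : ℤ, |v| < |u| ∧ M ^ (k + 1) = u • M + v • 1 := by
  induction k with
  | zero => exact ⟨1, 0, by simp, by simp⟩
  | succ k ih =>
    obtain ⟨u, v, huv, e⟩ := ih
    refine ⟨M.trace * u + v, -u, ?_, ?_⟩
    · have h1 : |M.trace * u| ≤ |M.trace * u + v| + |v| := by
        simpa using abs_sub (M.trace * u + v) v
      have h2 : 2 * |u| ≤ |M.trace * u| := by
        rw [abs_mul]
        exact mul_le_mul_of_nonneg_right ht (abs_nonneg u)
      rw [abs_neg]
      linarith
    · rw [pow_succ, e, add_mul, smul_mul_assoc, mul_self_eq, hd, smul_mul_assoc, one_mul]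
      module

theorem eq_one_or_neg_one_or_trace {M : Mat} (hd : M.det = 1) {n : ℕ} (hn : 0 < n)
    (h : M ^ n = 1) : M = 1 ∨ M = -1 ∨ |M.trace| ≤ 1 := by
  by_contra! hc
  obtain ⟨h1, h2, ht⟩ := hc
  obtain ⟨k, rfl⟩ := Nat.exists_eq_succ_of_ne_zero hn.ne'
  obtain ⟨u, v, huv, e⟩ := exists_pow_eq hd (by omega) k
  have hu : u ≠ 0 := by
    rintro rfl
    exact absurd huv (by simp)
  rw [Nat.succ_eq_add_one] at h
  rw [h] at e
  have e01 := congrFun (congrFun e 0) 1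
  have e10 := congrFun (congrFun e 1) 0
  have e00 := congrFun (congrFun e 0) 0
  have e11 := congrFun (congrFun e 1) 1
  simp [-zsmul_eq_mul, -zsmul_one, hu] at e01 e10 e00 e11
  have hdiag : M 0 0 = M 1 1 := by
    apply mul_left_cancel₀ hu
    linarith
  rw [Matrix.det_fin_two, e01, hdiag] at hd
  have hsq : M 1 1 = 1 ∨ M 1 1 = -1 := mul_self_eq_one_iff.1 (by linarith)
  rcases hsq with h3 | h3
  · apply h1
    ext i j
    fin_cases i <;> fin_cases j <;> simp [e01, e10, hdiag, h3]
  · apply h2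
    ext i j
    fin_cases i <;> fin_cases j <;> simp [e01, e10, hdiag, h3]

/-- The square has determinant 1 and trace `tr² + 2`, so the previous case leaves only trace 2 for
it. -/
theorem trace_of_det_neg_one {M : Mat} (hd : M.det = -1) {n : ℕ} (hn : 0 < n)
    (h : M ^ n = 1) : M.trace = 0 := by
  have hd2 : (M * M).det = 1 := by rw [Matrix.det_mul, hd]; norm_num
  have h2 : (M * M) ^ n = 1 := by rw [← pow_two, ← pow_mul, mul_comm, pow_mul, h, one_pow]
  have htr : (M * M).trace = M.trace ^ 2 + 2 := by
    rw [mul_self_eq, hd]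
    simp [Matrix.trace_fin_two, -zsmul_eq_mul, -zsmul_one]
    ring
  rcases eq_one_or_neg_one_or_trace hd2 hn h2 with h3 | h3 | h3
  · rw [h3] at htr
    simp at htr
    exact htr
  · rw [h3] at htr
    simp at htr
    nlinarith [sq_nonneg M.trace]
  · rw [htr] at h3
    have := abs_le.1 h3
    nlinarith [sq_nonneg M.trace]

/-- Conjugacy of matrices under automorphisms of the free group. -/
def MatConj (M N : Mat) : Prop := ∃ ψ : MulAut F2, N = toMat ψ * M * toMat ψ⁻¹

namespace MatConj

theorem refl (M : Mat) : MatConj M M := ⟨1, by simp⟩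

theorem trans {M N K : Mat} (h₁ : MatConj M N) (h₂ : MatConj N K) : MatConj M K := by
  obtain ⟨ψ, rfl⟩ := h₁
  obtain ⟨χ, rfl⟩ := h₂
  exact ⟨χ * ψ, by simp [mul_assoc]⟩

theorem toMat_inv_mul (ψ : MulAut F2) : toMat ψ⁻¹ * toMat ψ = 1 := by
  rw [← map_mul, inv_mul_cancel, map_one]

theorem toMat_mul_inv (ψ : MulAut F2) : toMat ψ * toMat ψ⁻¹ = 1 := by
  rw [← map_mul, mul_inv_cancel, map_one]

theorem trace_eq {M N : Mat} (h : MatConj M N) : N.trace = M.trace := by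
  obtain ⟨ψ, rfl⟩ := h
  rw [Matrix.trace_mul_comm, ← mul_assoc, toMat_inv_mul, one_mul]

theorem det_eq {M N : Mat} (h : MatConj M N) : N.det = M.det := by
  obtain ⟨ψ, rfl⟩ := h
  have := congrArg Matrix.det (toMat_mul_inv ψ)
  rw [Matrix.det_mul, Matrix.det_one] at this
  rw [Matrix.det_mul, Matrix.det_mul, mul_right_comm, this, one_mul]

theorem swap (a b c d : ℤ) : MatConj !![a, b; c, d] !![d, c; b, a] := by
  refine ⟨autP, ?_⟩
  rw [inv_eq_of_mul_eq_one_left autP_mul_self, toMat_autP]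
  simp

theorem sign (a b c d : ℤ) : MatConj !![a, b; c, d] !![a, -b; -c, d] := by
  refine ⟨autE, ?_⟩
  rw [inv_eq_of_mul_eq_one_left autE_mul_self, toMat_autE]
  simp

theorem toMat_autT_zpow (k : ℤ) : toMat (autT ^ k) = !![1, k; 0, 1] := by
  have ha : ∀ k : ℤ, (autT ^ k) genA = genA := by
    intro k
    have : autT ∈ MulAction.stabilizer (MulAut F2) genA := autT_genA
    exact zpow_mem this k
  have hb : ∀ k : ℤ, (autT ^ k) genB = genA ^ k * genB := by
    intro k
    induction k using Int.induction_on with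
    | zero => simp
    | succ k ih => rw [zpow_add_one, MulAut.mul_apply, autT_genB, map_mul, ha, ih]; group
    | pred k ih =>
      have : autT⁻¹ genB = genA⁻¹ * genB := by
        rw [← autT.injective.eq_iff, MulAut.apply_inv_self]
        simp
      rw [zpow_sub_one, MulAut.mul_apply, this, map_mul, map_inv, ha, ih]; group
  have hz : ∀ i, ex i (genA ^ k) = k * ex i genA := by
    intro i
    simp [ex]
  simp [toMat_apply, ha, hb, hz]

theorem shear (a b c d k : ℤ) :
    MatConj !![a, b; c, d] !![a + k * c, b + k * (d - a) - k ^ 2 * c; c, d - k * c] := by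
  refine ⟨autT ^ k, ?_⟩
  rw [← zpow_neg, toMat_autT_zpow, toMat_autT_zpow]
  simp
  constructor <;> ring

end MatConj

theorem exists_abs_add_le (x c : ℤ) (hc : c ≠ 0) : ∃ k : ℤ, |x + 2 * k * c| ≤ |c| := by
  have hpos : 0 < 2 * |c| := by positivity
  have h1 := Int.emod_add_mul_ediv (x + |c|) (2 * |c|)
  have h2 := Int.emod_nonneg (x + |c|) hpos.ne'
  have h3 := Int.emod_lt_of_pos (x + |c|) hpos
  -- Shifting by `|c|` centres the residue modulo `2 * |c|`; the sign turns `|c|` into `c`.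
  refine ⟨-((x + |c|) / (2 * |c|)) * c.sign, ?_⟩
  have h4 : c.sign * c = |c| := by rw [Int.sign_mul_self_eq_abs]
  have h5 : x + 2 * (-((x + |c|) / (2 * |c|)) * c.sign) * c =
      (x + |c|) % (2 * |c|) - |c| := by
    linear_combination (-2 * ((x + |c|) / (2 * |c|))) * h4 - h1
  rw [h5, abs_le]
  constructor <;> linarith

/-- Gauss reduction. -/
theorem exists_reduced (M : Mat) : ∃ N, MatConj M N ∧
    (N 1 0 = 0 ∨ N 1 0 ≠ 0 ∧ |N 0 0 - N 1 1| ≤ |N 1 0| ∧ |N 1 0| ≤ |N 0 1|) := by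
  -- A shear keeps the minimal lower-left entry and balances the diagonal; minimality against the
  -- swapped matrix bounds the upper-right entry from below.
  obtain ⟨N, hN, hmin⟩ : ∃ N, MatConj M N ∧ ∀ K, MatConj M K → (N 1 0).natAbs ≤ (K 1 0).natAbs := by
    have hex : ∃ n, ∃ N, MatConj M N ∧ (N 1 0).natAbs = n := ⟨_, M, .refl M, rfl⟩
    classical
    obtain ⟨N, hN, h⟩ := Nat.find_spec hex
    exact ⟨N, hN, fun K hK => h ▸ Nat.find_min' hex ⟨K, hK, rfl⟩⟩
  by_cases h0 : N 1 0 = 0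
  · exact ⟨N, hN, Or.inl h0⟩
  obtain ⟨k, hk⟩ := exists_abs_add_le (N 0 0 - N 1 1) (N 1 0) h0
  have hsh := MatConj.shear (N 0 0) (N 0 1) (N 1 0) (N 1 1) k
  rw [← Matrix.eta_fin_two N] at hsh
  have hK := hN.trans hsh
  refine ⟨_, hK, Or.inr ⟨by simpa using h0, ?_, ?_⟩⟩
  · simp only [Matrix.of_apply, Matrix.cons_val', Matrix.cons_val_zero, Matrix.cons_val_one]
    rw [show N 0 0 + k * N 1 0 - (N 1 1 - k * N 1 0) = N 0 0 - N 1 1 + 2 * k * N 1 0 by ring]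
    exact hk
  · have := hmin _ (hK.trans (MatConj.swap _ _ _ _))
    simp only [Matrix.of_apply, Matrix.cons_val', Matrix.cons_val_zero, Matrix.cons_val_one] at *
    rw [Int.abs_eq_natAbs, Int.abs_eq_natAbs]
    exact_mod_cast this

/-- The matrices of the standard representatives of finite-order outer automorphisms. -/
def IsStandard (M : Mat) : Prop :=
  M = 1 ∨ M = -1 ∨ M = toMat autE ∨ M = toMat autP ∨ M = toMat autX ∨ M = toMat autY ∨
    M = !![0, 1; -1, -1]

theorem toMat_autX : toMat autX = !![0, 1; -1, 0] := by simp [toMat_apply]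

theorem toMat_autY : toMat autY = !![1, 1; -1, 0] := by simp [toMat_apply]

/-- If `c ≠ 0`, then `2|a| ≤ |c| ≤ |b|` and `bc = 1 - a²` force `a = 0`. In the triangular case
shears change `b` by even amounts, and its parity decides the outcome. -/
theorem exists_standard_of_det_neg_one {M : Mat} (hd : M.det = -1) (ht : M.trace = 0) :
    ∃ N, MatConj M N ∧ (N = toMat autE ∨ N = toMat autP) := by
  obtain ⟨N, hMN, hN⟩ := exists_reduced M
  rw [← hMN.det_eq, Matrix.det_fin_two] at hd
  rw [← hMN.trace_eq, Matrix.trace_fin_two] at ht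
  rw [Matrix.eta_fin_two N] at hMN
  generalize N 0 0 = a at *
  generalize N 0 1 = b at *
  generalize N 1 0 = c at *
  generalize N 1 1 = d at *
  obtain rfl : d = -a := by omega
  rw [toMat_autE, toMat_autP]
  rcases hN with rfl | ⟨hc, h1, h2⟩
  · have ha : a = 1 ∨ a = -1 := mul_self_eq_one_iff.1 (by linarith)
    have hred : ∃ r : ℤ, (r = 0 ∨ r = 1) ∧ MatConj M !![a, r; 0, -a] := by
      refine ⟨b % 2, by omega, ?_⟩
      have := hMN.trans (MatConj.shear a b 0 (-a) (a * (b / 2)))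
      convert this using 1
      rcases ha with rfl | rfl <;> simp <;> omega
    obtain ⟨r, hr, hMr⟩ := hred
    rcases ha with rfl | rfl <;> rcases hr with rfl | rfl
    · exact ⟨_, hMr.trans (MatConj.swap _ _ _ _), Or.inl rfl⟩
    · refine ⟨_, (hMr.trans (MatConj.swap _ _ _ _)).trans (MatConj.shear _ _ _ _ 1), Or.inr ?_⟩
      norm_num
    · exact ⟨_, hMr, Or.inl rfl⟩
    · refine ⟨_, (hMr.trans (MatConj.swap _ _ _ _)).trans (MatConj.shear _ _ _ _ (-1)), Or.inr ?_⟩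
      norm_num
  · have h3 : |a - -a| = 2 * |a| := by rw [sub_neg_eq_add, ← two_mul, abs_mul]; rfl
    have h4 : |b * c| = |b| * |c| := abs_mul b c
    have h5 : b * c = 1 - a ^ 2 := by linarith
    have ha : a = 0 := by
      by_contra ha
      have h6 : 1 ≤ |a| := Int.one_le_abs ha
      have h7 : |b * c| = a ^ 2 - 1 := by
        rw [h5, abs_of_nonpos] <;> nlinarith [sq_abs a]
      nlinarith [sq_abs a, abs_nonneg b, abs_nonneg c]
    subst ha
    have hbc : b * c = 1 := by linarith
    rcases Int.eq_one_or_neg_one_of_mul_eq_one' hbc with ⟨rfl, rfl⟩ | ⟨rfl, rfl⟩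
    · exact ⟨_, hMN, Or.inr (by simp)⟩
    · exact ⟨_, hMN.trans (MatConj.sign _ _ _ _), Or.inr (by simp)⟩

/-- Reducedness in `4bc = (a + d)² - (a - d)² - 4` yields `3c² ≤ 4`, so `|c| = 1` and few matrices
remain. -/
theorem exists_standard_of_trace {M : Mat} (hd : M.det = 1) (ht : |M.trace| ≤ 1) :
    ∃ N, MatConj M N ∧ (N = toMat autX ∨ N = toMat autY ∨ N = !![0, 1; -1, -1]) := by
  obtain ⟨N, hMN, hN⟩ := exists_reduced M
  rw [← hMN.det_eq, Matrix.det_fin_two] at hd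
  rw [← hMN.trace_eq, Matrix.trace_fin_two] at ht
  rw [Matrix.eta_fin_two N] at hMN
  generalize N 0 0 = a at *
  generalize N 0 1 = b at *
  generalize N 1 0 = c at *
  generalize N 1 1 = d at *
  rw [toMat_autX, toMat_autY]
  rw [abs_le] at ht
  rcases hN with rfl | ⟨hc, h1, h2⟩
  · have had : a * d = 1 := by linarith
    rcases Int.eq_one_or_neg_one_of_mul_eq_one' had with ⟨rfl, rfl⟩ | ⟨rfl, rfl⟩ <;> omega
  · have h4 : |b * c| = |b| * |c| := abs_mul b c
    have h5 : 4 * (b * c) = (a + d) ^ 2 - (a - d) ^ 2 - 4 := by linarith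
    have h6 : (a + d) ^ 2 ≤ 1 := by nlinarith
    have h7 : |b * c| = -(b * c) := abs_of_nonpos (by nlinarith [sq_nonneg (a - d)])
    have h8 : (a - d) ^ 2 ≤ c ^ 2 := sq_le_sq.2 h1
    have hc1 : |c| = 1 := by
      have h9 : 1 ≤ |c| := Int.one_le_abs hc
      have h10 : |c| ^ 2 ≤ |b| * |c| := by nlinarith
      have h11 : |c| < 2 := by nlinarith [sq_abs c, sq_nonneg (a + d)]
      omega
    rw [hc1, abs_le] at h1
    have hbc : b * c = -1 := by
      have : a = 0 ∨ a = 1 ∨ a = -1 := by omega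
      have : d = 0 ∨ d = 1 ∨ d = -1 := by omega
      rcases ‹a = 0 ∨ a = 1 ∨ a = -1› with rfl | rfl | rfl <;>
        rcases ‹d = 0 ∨ d = 1 ∨ d = -1› with rfl | rfl | rfl <;> omega
    have key : MatConj M !![a, 1; -1, d] := by
      rcases eq_or_eq_neg_of_abs_eq hc1 with rfl | rfl
      · obtain rfl : b = -1 := by linarith
        simpa using hMN.trans (MatConj.sign _ _ _ _)
      · obtain rfl : b = 1 := by linarith
        exact hMN
    have had : a * d = 0 := by linarith
    rcases mul_eq_zero.1 had with rfl | rfl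
    · obtain rfl | rfl | rfl : d = 0 ∨ d = 1 ∨ d = -1 := by omega
      · exact ⟨_, key, by simp⟩
      · exact ⟨_, (key.trans (MatConj.swap _ _ _ _)).trans (MatConj.sign _ _ _ _), by simp⟩
      · exact ⟨_, key, by simp⟩
    · obtain rfl | rfl | rfl : a = 0 ∨ a = 1 ∨ a = -1 := by omega
      · exact ⟨_, key, by simp⟩
      · exact ⟨_, key, by simp⟩
      · exact ⟨_, (key.trans (MatConj.swap _ _ _ _)).trans (MatConj.sign _ _ _ _), by simp⟩

theorem exists_standard {M : Mat} {n : ℕ} (hn : 0 < n) (h : M ^ n = 1) :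
    ∃ N, MatConj M N ∧ IsStandard N := by
  have hu : IsUnit M.det := by
    have := congrArg Matrix.det h
    rw [Matrix.det_pow, Matrix.det_one] at this
    exact IsUnit.of_pow_eq_one this hn.ne'
  rcases Int.isUnit_iff.1 hu with hd | hd
  · rcases eq_one_or_neg_one_or_trace hd hn h with h1 | h1 | h1
    · exact ⟨M, .refl M, Or.inl h1⟩
    · exact ⟨M, .refl M, Or.inr (Or.inl h1)⟩
    · obtain ⟨N, hN, h2⟩ := exists_standard_of_trace hd h1
      exact ⟨N, hN, by unfold IsStandard; tauto⟩
  · obtain ⟨N, hN, h2⟩ := exists_standard_of_det_neg_one hd (trace_of_det_neg_one hd hn h)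
    exact ⟨N, hN, by unfold IsStandard; tauto⟩

end Matrices

/-! ### Twisted conjugacy and pairs of automorphisms. -/

section TwistedConjugacy

/-- `w` and `s` are conjugate with respect to the action twisted by `φ`. -/
def TwConj {G : Type*} [Group G] (φ : MulAut G) (w s : G) : Prop := ∃ u, w = u * s * (φ u)⁻¹

theorem TwConj.refl {G : Type*} [Group G] (φ : MulAut G) (w : G) : TwConj φ w w := ⟨1, by simp⟩

theorem TwConj.trans {G : Type*} [Group G] {φ : MulAut G} {w s t : G} (h₁ : TwConj φ w s)
    (h₂ : TwConj φ s t) : TwConj φ w t := by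
  obtain ⟨u, rfl⟩ := h₁
  obtain ⟨v, rfl⟩ := h₂
  exact ⟨u * v, by simp [mul_assoc]⟩

theorem TwConj.inv_of_map_eq_inv {G : Type*} [Group G] {φ : MulAut G} {s : G} (h : φ s = s⁻¹) :
    TwConj φ s s⁻¹ := ⟨s, by simp [h]⟩

theorem conj_mul_pow {G : Type*} [Group G] (φ : MulAut G) (w : G) (n : ℕ) :
    (MulAut.conj w * φ) ^ n = MulAut.conj (twistedPow φ w n) * φ ^ n := by
  induction n with
  | zero => simp [twistedPow]
  | succ n ih =>
    rw [pow_succ', ih, twistedPow_succ, pow_succ', map_mul, mul_assoc, ← mul_assoc φ, mul_conj]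
    simp only [mul_assoc]

theorem twistedPow_eq_one {φ : MulAut F2} {w : F2} {n k : ℕ}
    (h : (MulAut.conj w * φ) ^ n = 1) (hφ : φ ^ k = 1) : twistedPow φ w (n * k) = 1 := by
  apply conj_injective
  have := conj_mul_pow φ w (n * k)
  rw [pow_mul, h, one_pow, mul_comm n k, pow_mul, hφ, one_pow, mul_one, mul_comm k n] at this
  rw [← this, map_one]

/-- The element of the holomorph that corresponds to the pair of automorphisms `τ_w φ`,
`τ_w' φ` with the same outer class. -/
def pairElt (φ : MulAut F2) (w' w : F2) : Hol := ⟨w' * w⁻¹, MulAut.conj w * φ⟩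

/-- The conjugator corresponds to the pair of inner automorphisms of `u'` and `u`, so the
coordinates change independently. -/
theorem isConj_pairElt_of_twConj {φ : MulAut F2} {w' w s' s : F2} (h' : TwConj φ w' s')
    (h : TwConj φ w s) : IsConj (pairElt φ w' w) (pairElt φ s' s) := by
  obtain ⟨u', rfl⟩ := h'
  obtain ⟨u, rfl⟩ := h
  refine IsConj.symm (isConj_iff.2 ⟨⟨u' * u⁻¹, MulAut.conj u⟩, ?_⟩)
  rw [mul_inv_eq_iff_eq_mul]
  refine SemidirectProduct.ext ?_ ?_
  · simp [pairElt, mul_assoc]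
  · simp only [pairElt, SemidirectProduct.mul_right]
    rw [mul_assoc, mul_conj, ← mul_assoc, ← mul_assoc, ← map_mul, ← map_mul,
      inv_mul_cancel_right]

/-- An automorphism centralizing the outer class of `φ` acts on both coordinates at once, with the
correction `z`. -/
theorem isConj_pairElt_of_mul_eq {φ ψ : MulAut F2} {z : F2}
    (h : ψ * φ = MulAut.conj z * φ * ψ) (w' w : F2) :
    IsConj (pairElt φ w' w) (pairElt φ (ψ w' * z) (ψ w * z)) := by
  refine isConj_iff.2 ⟨SemidirectProduct.inr ψ, ?_⟩
  rw [mul_inv_eq_iff_eq_mul]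
  refine SemidirectProduct.ext ?_ ?_
  · simp [pairElt, mul_assoc]
  · simp only [pairElt, SemidirectProduct.mul_right, SemidirectProduct.right_inr]
    rw [← mul_assoc, mul_conj, mul_assoc, h, map_mul]
    simp only [mul_assoc]

/-- The homomorphism `w φ ↦ τ_w φ`. -/
def holToAut : Hol →* MulAut F2 where
  toFun g := MulAut.conj g.left * g.right
  map_one' := by simp
  map_mul' g h := by
    simp only [SemidirectProduct.mul_left, SemidirectProduct.mul_right, map_mul, MonoidHom.id_apply]
    rw [mul_assoc, mul_assoc, ← mul_assoc (MulAut.conj (g.right h.left)), ← mul_conj]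
    simp only [mul_assoc]

theorem holToAut_pairElt (φ : MulAut F2) (w' w : F2) :
    holToAut (pairElt φ w' w) = MulAut.conj w' * φ := by
  simp only [holToAut, pairElt, MonoidHom.coe_mk, OneHom.coe_mk, map_mul, map_inv, mul_assoc,
    inv_mul_cancel_left]

theorem twistedPow_of_pairElt {φ : MulAut F2} {w' w : F2} {n k : ℕ}
    (h : pairElt φ w' w ^ n = 1) (hφ : φ ^ k = 1) :
    twistedPow φ w' (n * k) = 1 ∧ twistedPow φ w (n * k) = 1 := by
  constructor
  · apply twistedPow_eq_one _ hφ
    rw [← holToAut_pairElt φ w' w, ← map_pow, h, map_one]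
  · apply twistedPow_eq_one _ hφ
    have := congrArg SemidirectProduct.rightHom h
    rwa [map_pow, map_one] at this

theorem exists_isConj_pairElt {g : Hol} {φ ψ : MulAut F2}
    (h : toMat φ = toMat ψ * toMat g.right * toMat ψ⁻¹) : ∃ w' w, IsConj g (pairElt φ w' w) := by
  obtain ⟨w, hw⟩ := exists_conj_of_toMat_eq_one (φ := ψ * g.right * ψ⁻¹ * φ⁻¹) (by
    rw [map_mul, map_mul, map_mul, ← h, ← map_mul, mul_inv_cancel, map_one])
  refine ⟨ψ g.left * w, w, isConj_iff.2 ⟨SemidirectProduct.inr ψ, ?_⟩⟩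
  rw [mul_inv_eq_iff_eq_mul] at *
  refine SemidirectProduct.ext ?_ ?_
  · simp [pairElt]
  · simp only [pairElt, SemidirectProduct.mul_right, SemidirectProduct.right_inr, ← hw,
      inv_mul_cancel_right]

end TwistedConjugacy

/-! ### Twist classes for automorphisms permuting the letters. -/

section LetterPermutations

theorem twConj_of_twistedPow {φ : MulAut F2} {f : Fin 2 × Bool → Fin 2 × Bool}
    (hf : ActsOnLetters φ f) {w : F2} {n : ℕ} (hn : 0 < n) (h : twistedPow φ w n = 1) :
    TwConj φ w 1 ∨ ∃ l, f l = flipLetter l ∧ TwConj φ w (mk [l]) := by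
  obtain ⟨k, h | ⟨l, hl, h⟩⟩ := hf.exists_of_twistedPow hn h
  · exact Or.inl ⟨_, by rwa [mul_one]⟩
  · exact Or.inr ⟨l, hl, _, h⟩

theorem actsOnLetters_one : ActsOnLetters (1 : MulAut F2) id :=
  ⟨Function.injective_id, fun _ => rfl⟩

theorem actsOnLetters_autP : ActsOnLetters autP fun l => (1 - l.1, l.2) := by
  refine ⟨?_, autP_mk⟩
  rintro ⟨i, s⟩ ⟨j, t⟩ h
  simpa using h

theorem actsOnLetters_autE :
    ActsOnLetters autE fun l => (l.1, if l.1 = 0 then !l.2 else l.2) := by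
  refine ⟨?_, autE_mk⟩
  decide

theorem actsOnLetters_autX :
    ActsOnLetters autX fun l => (1 - l.1, if l.1 = 0 then !l.2 else l.2) := by
  refine ⟨by decide, ?_⟩
  rintro ⟨i, s⟩
  fin_cases i <;> cases s <;>
    simp [mk_zero_true, mk_one_true, mk_zero_false, mk_one_false]

/-- The inversion `a ↦ a⁻¹`, `b ↦ b⁻¹`. -/
def autI : MulAut F2 := autX ^ 2

@[simp] theorem autI_genA : autI genA = genA⁻¹ := by simp [autI, pow_two]
@[simp] theorem autI_genB : autI genB = genB⁻¹ := by simp [autI, pow_two]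

theorem actsOnLetters_autI : ActsOnLetters autI flipLetter := by
  refine ⟨by decide, ?_⟩
  rintro ⟨i, s⟩
  fin_cases i <;> cases s <;>
    simp [mk_zero_true, mk_one_true, mk_zero_false, mk_one_false, flipLetter]

theorem autI_pow_two : autI ^ 2 = 1 := by
  rw [pow_two]
  exact aut_ext (by simp) (by simp)

theorem autX_pow_four : autX ^ 4 = 1 := by
  rw [show 4 = 2 * 2 from rfl, pow_mul]
  exact autI_pow_two

theorem eq_one_of_twistedPow_one {w : F2} {n : ℕ} (hn : 0 < n) (h : twistedPow 1 w n = 1) :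
    w = 1 := by
  rcases twConj_of_twistedPow actsOnLetters_one hn h with ⟨u, hu⟩ | ⟨l, hl, -⟩
  · simpa using hu
  · exfalso; revert l; decide

theorem twConj_autP {w : F2} {n : ℕ} (hn : 0 < n) (h : twistedPow autP w n = 1) :
    TwConj autP w 1 := by
  rcases twConj_of_twistedPow actsOnLetters_autP hn h with h | ⟨l, hl, -⟩
  · exact h
  · exfalso; revert l; decide

theorem twConj_autX {w : F2} {n : ℕ} (hn : 0 < n) (h : twistedPow autX w n = 1) :
    TwConj autX w 1 := by
  rcases twConj_of_twistedPow actsOnLetters_autX hn h with h | ⟨l, hl, -⟩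
  · exact h
  · exfalso; revert l; decide

theorem twConj_autE {w : F2} {n : ℕ} (hn : 0 < n) (h : twistedPow autE w n = 1) :
    TwConj autE w 1 ∨ TwConj autE w genA⁻¹ := by
  rcases twConj_of_twistedPow actsOnLetters_autE hn h with h | ⟨⟨i, s⟩, hl, h⟩
  · exact Or.inl h
  · right
    fin_cases i <;> cases s <;> simp [flipLetter] at hl
    · exact h
    · exact h.trans (TwConj.inv_of_map_eq_inv autE_genA)

theorem twConj_autI {w : F2} {n : ℕ} (hn : 0 < n) (h : twistedPow autI w n = 1) :
    TwConj autI w 1 ∨ TwConj autI w genA⁻¹ ∨ TwConj autI w genB⁻¹ := by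
  rcases twConj_of_twistedPow actsOnLetters_autI hn h with h | ⟨⟨i, s⟩, hl, h⟩
  · exact Or.inl h
  · right
    fin_cases i <;> cases s
    · exact Or.inl h
    · exact Or.inl (h.trans (TwConj.inv_of_map_eq_inv autI_genA))
    · exact Or.inr h
    · exact Or.inr (h.trans (TwConj.inv_of_map_eq_inv autI_genB))

end LetterPermutations

/-! ### The outer class of `y` has no finite-order lift. -/

section OrderSix

theorem autY_pow_three : autY ^ 3 = MulAut.conj (genA * genB⁻¹) * autI := by
  rw [pow_succ, pow_two]
  exact aut_ext (by simp [mul_assoc]) (by simp [mul_assoc])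

/-- No automorphism in the outer class of `y` has finite order. -/
theorem conj_mul_autY_pow_ne_one (w : F2) {n : ℕ} (hn : 0 < n) :
    (MulAut.conj w * autY) ^ n ≠ 1 := by
  intro h
  have h3 : (MulAut.conj (twistedPow autY w 3 * (genA * genB⁻¹)) * autI) ^ n = 1 := by
    rw [map_mul, mul_assoc, ← autY_pow_three, ← conj_mul_pow, ← pow_mul, mul_comm, pow_mul, h,
      one_pow]
  have e : twistedPow autY w 3 = w * autY (w * autY w) := by
    rw [twistedPow_succ, twistedPow_succ, twistedPow_succ]
    simp [twistedPow]
  have hI : ∀ i u, ex i (autI u) = -ex i u := by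
    intro i u
    rw [ex_apply]
    fin_cases i <;> simp [toMat_apply]
  have hY0 : ∀ u, ex 0 (autY u) = ex 0 u + ex 1 u := by
    intro u
    rw [ex_apply]
    simp [toMat_apply]
  have hY1 : ∀ u, ex 1 (autY u) = -ex 0 u := by
    intro u
    rw [ex_apply]
    simp [toMat_apply]
  -- On exponents, `1 + Y + Y²` is even, so adding `a b⁻¹` makes both exponent sums odd. Elements
  -- twisted conjugate to 1, `a⁻¹` or `b⁻¹` have at most one odd exponent sum.
  rcases twConj_autI (by positivity) (twistedPow_eq_one h3 autI_pow_two) with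
    ⟨u, hu⟩ | ⟨u, hu⟩ | ⟨u, hu⟩ <;>
  · have h0 := congrArg (ex 0) hu
    have h1 := congrArg (ex 1) hu
    rw [e] at h0 h1
    simp [hI, hY0, hY1] at h0 h1
    omega

end OrderSix

/-! ### Order three, through the theta graph. -/

section OrderThree

/-- The automorphism `a ↦ b⁻¹`, `b ↦ a b⁻¹` of order three. -/
def autW : MulAut F2 := autY ^ 2 * (MulAut.conj genB)⁻¹

@[simp] theorem autW_genA : autW genA = genB⁻¹ := by
  simp [autW, pow_two, mul_assoc]

@[simp] theorem autW_genB : autW genB = genA * genB⁻¹ := by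
  simp [autW, pow_two, mul_assoc]

theorem autW_pow_three : autW ^ 3 = 1 := by
  rw [pow_succ, pow_two]
  exact aut_ext (by simp [mul_assoc]) (by simp [mul_assoc])

/-- The free group on the three edges of the theta graph. -/
abbrev F3 : Type := FreeGroup (Fin 3)

/-- The cyclic rotation of the three edges. -/
def rotation : MulAut F3 := FreeGroup.freeGroupCongr (Equiv.addRight 1)

theorem rotation_of (i : Fin 3) : rotation (of i) = of (i + 1) := by
  simp [rotation]

theorem actsOnLetters_rotation : ActsOnLetters rotation fun l => (l.1 + 1, l.2) := by
  refine ⟨?_, ?_⟩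
  · rintro ⟨i, s⟩ ⟨j, t⟩ h
    simpa using h
  · rintro ⟨i, s⟩
    simp [rotation, FreeGroup.freeGroupCongr]

/-- The fundamental group of the theta graph inside the free group on its edges. -/
def theta : F2 →* F3 := FreeGroup.lift ![of 0 * (of 1)⁻¹, of 2 * (of 1)⁻¹]

@[simp] theorem theta_genA : theta genA = of 0 * (of 1)⁻¹ := by simp [theta, genA]
@[simp] theorem theta_genB : theta genB = of 2 * (of 1)⁻¹ := by simp [theta, genB]

theorem hom_ext {G : Type*} [Group G] {f g : F2 →* G} (ha : f genA = g genA)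
    (hb : f genB = g genB) : f = g := by
  ext i
  fin_cases i
  · exact ha
  · exact hb

theorem theta_injective : Function.Injective theta := by
  let r : F3 →* F2 := FreeGroup.lift ![genA, 1, genB]
  have : r.comp theta = MonoidHom.id F2 := hom_ext (by simp [r]) (by simp [r])
  exact Function.LeftInverse.injective (g := r) fun w => DFunLike.congr_fun this w

theorem theta_autW (w : F2) : theta (autW w) = rotation (theta w) := by
  have : theta.comp autW.toMonoidHom = rotation.toMonoidHom.comp theta :=
    hom_ext (by simp [rotation_of]) (by simp [rotation_of])
  exact DFunLike.congr_fun this w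

theorem theta_twistedPow (w : F2) (n : ℕ) :
    theta (twistedPow autW w n) = twistedPow rotation (theta w) n := by
  induction n with
  | zero => simp [twistedPow]
  | succ n ih => rw [twistedPow_succ, twistedPow_succ, map_mul, theta_autW, ih]

/-- The signs of the letters alternate, starting with the given sign. -/
def Alternates {α : Type*} : Bool → List (α × Bool) → Prop
  | _, [] => True
  | s, l :: L => l.2 = s ∧ Alternates (!s) L

theorem Alternates.of_step {α : Type*} {L M : List (α × Bool)} (h : FreeGroup.Red.Step L M)
    {s : Bool} (hL : Alternates s L) : Alternates s M := by
  obtain ⟨⟩ := h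
  rename_i L₁ L₂ x b
  induction L₁ generalizing s with
  | nil => simpa [Alternates] using hL.2.2
  | cons l L ih => exact ⟨hL.1, ih hL.2⟩

theorem Alternates.of_red {α : Type*} {L M : List (α × Bool)} (h : FreeGroup.Red L M)
    {s : Bool} (hL : Alternates s L) : Alternates s M := by
  induction h with
  | refl => exact hL
  | tail _ h ih => exact ih.of_step h

theorem Alternates.take {α : Type*} {L : List (α × Bool)} {s : Bool} (hL : Alternates s L)
    (k : ℕ) : Alternates s (L.take k) := by
  induction L generalizing s k with
  | nil => simpa using hL
  | cons l L ih =>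
    cases k with
    | zero => trivial
    | succ k => exact ⟨hL.1, ih hL.2 k⟩

/-- The arbitrary continuation `L` encodes that `K` alternates and has even length, a property
stable under products. -/
theorem exists_alternates (w : F2) :
    ∃ K, mk K = theta w ∧ ∀ L, Alternates true L → Alternates true (K ++ L) := by
  induction w using FreeGroup.induction_on with
  | C1 => exact ⟨[], by simp [← FreeGroup.one_eq_mk], fun L hL => hL⟩
  | of i =>
    fin_cases i
    · exact ⟨[(0, true), (1, false)], theta_genA.symm, fun L hL => ⟨rfl, rfl, hL⟩⟩
    · exact ⟨[(2, true), (1, false)], theta_genB.symm, fun L hL => ⟨rfl, rfl, hL⟩⟩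
  | inv_of i _ =>
    fin_cases i
    · exact ⟨[(1, true), (0, false)], (by
        change _ = theta genA⁻¹
        rw [map_inv, theta_genA, mul_inv_rev, inv_inv]
        rfl), fun L hL => ⟨rfl, rfl, hL⟩⟩
    · exact ⟨[(1, true), (2, false)], (by
        change _ = theta genB⁻¹
        rw [map_inv, theta_genB, mul_inv_rev, inv_inv]
        rfl), fun L hL => ⟨rfl, rfl, hL⟩⟩
  | mul u v hu hv =>
    obtain ⟨K, hK, hK'⟩ := hu
    obtain ⟨K₁, hK₁, hK₁'⟩ := hv
    refine ⟨K ++ K₁, by rw [← FreeGroup.mul_mk, hK, hK₁, map_mul], fun L hL => ?_⟩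
    rw [List.append_assoc]
    exact hK' _ (hK₁' L hL)

theorem alternates_toWord_theta (w : F2) : Alternates true (theta w).toWord := by
  obtain ⟨K, hK, hK'⟩ := exists_alternates w
  have := hK' [] trivial
  rw [List.append_nil] at this
  rw [← hK, FreeGroup.toWord_mk]
  exact this.of_red FreeGroup.reduce.red

theorem of_mul_inv_mem (i : Fin 3) : of i * (of 0)⁻¹ ∈ theta.range := by
  fin_cases i
  · exact ⟨1, by simp⟩
  · exact ⟨genA⁻¹, by simp⟩
  · exact ⟨genB * genA⁻¹, by simp⟩

/-- Alternating words are edge paths between the two vertices. Edge `0`, added at whichever ends are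
away from the base point, closes them into loops. -/
theorem mem_range_of_alternates (L : List (Fin 3 × Bool)) :
    (Alternates true L → mk L ∈ theta.range ∨ mk L * (of 0)⁻¹ ∈ theta.range) ∧
      (Alternates false L → of 0 * mk L ∈ theta.range ∨ of 0 * mk L * (of 0)⁻¹ ∈ theta.range) := by
  induction L with
  | nil => exact ⟨fun _ => Or.inl (one_mem _), fun _ => Or.inr (by simp [← FreeGroup.one_eq_mk])⟩
  | cons l L ih =>
    obtain ⟨i, s⟩ := l
    have e : mk ((i, s) :: L) = mk [(i, s)] * mk L := by simp
    constructor
    · rintro ⟨h1, h2⟩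
      obtain rfl : s = true := h1
      have hi := of_mul_inv_mem i
      rw [e]
      rcases ih.2 h2 with h | h
      · left
        convert mul_mem hi h using 1
        change of i * _ = _
        group
      · right
        convert mul_mem hi h using 1
        change of i * _ * _ = _
        group
    · rintro ⟨h1, h2⟩
      obtain rfl : s = false := h1
      have hi := inv_mem (of_mul_inv_mem i)
      rw [mul_inv_rev, inv_inv] at hi
      rw [e]
      rcases ih.1 h2 with h | h
      · left
        convert mul_mem hi h using 1
        change of 0 * ((of i)⁻¹ * _) = _
        group
      · right
        convert mul_mem hi h using 1
        change of 0 * ((of i)⁻¹ * _) * _ = _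
        group

/-- The rotation inverts no edge, so `theta w = u (rotation u)⁻¹` with `u` an initial path of `theta
w`. If `u` is closed, `w` is twisted conjugate to 1; otherwise `u` is a loop followed by edge `0`,
which leaves the twist `a`, equivalent to `b⁻¹`. -/
theorem twConj_autW {w : F2} {n : ℕ} (hn : 0 < n) (h : twistedPow autW w n = 1) :
    TwConj autW w 1 ∨ TwConj autW w genB⁻¹ := by
  have h' : twistedPow rotation (theta w) n = 1 := by rw [← theta_twistedPow, h, map_one]
  obtain ⟨k, h | ⟨l, hl, -⟩⟩ := actsOnLetters_rotation.exists_of_twistedPow hn h'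
  · have halt := (alternates_toWord_theta w).take k
    set u := mk ((theta w).toWord.take k) with hu
    rcases (mem_range_of_alternates _).1 halt with ⟨v, hv⟩ | ⟨v, hv⟩
    · left
      refine ⟨v, theta_injective ?_⟩
      rw [h, mul_one, map_mul, map_inv, theta_autW, hv, hu]
    · right
      refine TwConj.trans (s := genA) ⟨v, theta_injective ?_⟩ ⟨genA, by simp⟩
      have hu' : u = theta v * of 0 := by rw [hv, inv_mul_cancel_right]
      rw [h, hu', map_mul, map_mul, map_mul, map_inv, theta_autW, theta_genA, rotation_of]
      simp [mul_assoc]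
  · exact absurd (congrArg Prod.snd hl) (by simp [flipLetter])

end OrderThree

/-! ### The representatives as pairs, and their orders. -/

section Representatives

/-- The standard automorphisms underlying the ten representatives. -/
def repBase : Fin 10 → MulAut F2 :=
  ![autP, autE, autE, autE, autE, autI, autI, autW, autW, autX]

/-- The twisting elements of the ten representatives. -/
def repTwist : Fin 10 → F2 × F2 :=
  ![(1, 1), (1, 1), (genA⁻¹, 1), (genA⁻¹, genA⁻¹), (genA⁻¹ * genA⁻¹, genA⁻¹), (1, 1), (genB⁻¹, 1),
    (1, 1), (genB⁻¹, 1), (1, 1)]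

theorem inr_eq_pairElt (φ : MulAut F2) : SemidirectProduct.inr φ = pairElt φ 1 1 :=
  SemidirectProduct.ext (by simp [pairElt]) (by simp [pairElt])

theorem rep_eq (i : Fin 10) : rep i = pairElt (repBase i) (repTwist i).1 (repTwist i).2 := by
  have hE : p * x = SemidirectProduct.inr autE := by rw [p, x, autE, map_mul]
  have hI : x ^ 2 = SemidirectProduct.inr autI := by rw [x, autI, map_pow]
  have hW : y ^ 2 * τb⁻¹ = SemidirectProduct.inr autW := by
    rw [y, τb, autW, map_mul, map_pow, map_inv]
  have hEa : autE * MulAut.conj genA = MulAut.conj genA⁻¹ * autE := by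
    rw [mul_conj, autE_genA]
  have hinr : ∀ (φ : MulAut F2) (u : F2),
      SemidirectProduct.inr φ * SemidirectProduct.inl u = (pairElt φ (φ u) 1 : Hol) :=
    fun φ u => SemidirectProduct.ext (by simp [pairElt]) (by simp [pairElt])
  fin_cases i
  · exact inr_eq_pairElt autP
  · exact hE.trans (inr_eq_pairElt autE)
  · change p * x * a = pairElt autE genA⁻¹ 1
    rw [hE, a, hinr, autE_genA]
  · change p * x * τa = pairElt autE genA⁻¹ genA⁻¹
    rw [hE, τa, ← map_mul, hEa]
    exact SemidirectProduct.ext (by simp [pairElt]) (by simp [pairElt])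
  · change p * x * τa * a = pairElt autE (genA⁻¹ * genA⁻¹) genA⁻¹
    rw [hE, τa, ← map_mul, hEa]
    exact SemidirectProduct.ext (by simp [pairElt, a]) (by simp [pairElt, a])
  · exact hI.trans (inr_eq_pairElt autI)
  · change x ^ 2 * b = pairElt autI genB⁻¹ 1
    rw [hI, b, hinr, autI_genB]
  · exact hW.trans (inr_eq_pairElt autW)
  · change y ^ 2 * τb⁻¹ * a = pairElt autW genB⁻¹ 1
    rw [hW, a, hinr, autW_genA]
  · exact inr_eq_pairElt autX

/-- The two projections to Aut(F₂) are jointly injective, so the power may be checked in each. -/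
theorem pairElt_pow_eq_one {φ : MulAut F2} {w' w : F2} {n : ℕ} (hφ : φ ^ n = 1)
    (hw' : twistedPow φ w' n = 1) (hw : twistedPow φ w n = 1) : pairElt φ w' w ^ n = 1 := by
  have h1 : SemidirectProduct.rightHom (pairElt φ w' w ^ n) = 1 := by
    rw [map_pow]
    change (MulAut.conj w * φ) ^ n = 1
    rw [conj_mul_pow, hw, hφ, map_one, mul_one]
  have h2 : holToAut (pairElt φ w' w ^ n) = 1 := by
    rw [map_pow, holToAut_pairElt, conj_mul_pow, hw', hφ, map_one, mul_one]
  generalize pairElt φ w' w ^ n = g at *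
  refine SemidirectProduct.ext ?_ h1
  apply conj_injective
  change MulAut.conj g.left * g.right = 1 at h2
  change g.right = 1 at h1
  rw [h1, mul_one] at h2
  rw [h2, SemidirectProduct.one_left, map_one]

theorem twistedPow_two {G : Type*} [Group G] (φ : MulAut G) (w : G) :
    twistedPow φ w 2 = w * φ w := by
  rw [twistedPow_succ, twistedPow_succ]
  simp [twistedPow]

theorem twistedPow_three {G : Type*} [Group G] (φ : MulAut G) (w : G) :
    twistedPow φ w 3 = w * φ (w * φ w) := by
  rw [twistedPow_succ, twistedPow_two]

theorem pairElt_ne_one {φ : MulAut F2} (h : toMat φ ≠ 1) (w' w : F2) : pairElt φ w' w ≠ 1 := by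
  intro e
  apply h
  have : MulAut.conj w * φ = 1 := congrArg SemidirectProduct.right e
  have := congrArg toMat this
  rwa [map_mul, toMat_conj, one_mul, map_one] at this

theorem toMat_autI : toMat autI = !![-1, 0; 0, -1] := by simp [toMat_apply]

theorem toMat_autW : toMat autW = !![0, 1; -1, -1] := by simp [toMat_apply]

theorem toMat_repBase_ne_one (i : Fin 10) : toMat (repBase i) ≠ 1 := by
  have h0 : toMat autP ≠ 1 := by rw [toMat_autP]; decide
  have h1 : toMat autE ≠ 1 := by rw [toMat_autE]; decide
  have h2 : toMat autI ≠ 1 := by rw [toMat_autI]; decide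
  have h3 : toMat autW ≠ 1 := by rw [toMat_autW]; decide
  have h4 : toMat autX ≠ 1 := by rw [toMat_autX]; decide
  fin_cases i <;> assumption

theorem orderOf_rep (i : Fin 10) : orderOf (rep i) = repOrder i := by
  have hne : rep i ≠ 1 := by
    rw [rep_eq]
    exact pairElt_ne_one (toMat_repBase_ne_one i) _ _
  have hP : autP ^ 2 = 1 := by rw [pow_two, autP_mul_self]
  have hE : autE ^ 2 = 1 := by rw [pow_two, autE_mul_self]
  have two : ∀ {φ : MulAut F2} {w' w : F2}, φ ^ 2 = 1 → w' * φ w' = 1 → w * φ w = 1 →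
      rep i = pairElt φ w' w → orderOf (rep i) = 2 := by
    intro φ w' w h1 h2 h3 h4
    refine orderOf_eq_prime ?_ hne
    rw [h4]
    exact pairElt_pow_eq_one h1 (by rwa [twistedPow_two]) (by rwa [twistedPow_two])
  have three : ∀ {φ : MulAut F2} {w' w : F2}, φ ^ 3 = 1 → w' * φ (w' * φ w') = 1 →
      w * φ (w * φ w) = 1 → rep i = pairElt φ w' w → orderOf (rep i) = 3 := by
    intro φ w' w h1 h2 h3 h4
    have : Fact (Nat.Prime 3) := ⟨Nat.prime_three⟩
    refine orderOf_eq_prime ?_ hne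
    rw [h4]
    exact pairElt_pow_eq_one h1 (by rwa [twistedPow_three]) (by rwa [twistedPow_three])
  fin_cases i
  · exact two hP (by simp [repTwist]) (by simp [repTwist]) (rep_eq 0)
  · exact two hE (by simp [repTwist]) (by simp [repTwist]) (rep_eq 1)
  · exact two hE (by simp [repTwist]) (by simp [repTwist]) (rep_eq 2)
  · exact two hE (by simp [repTwist]) (by simp [repTwist]) (rep_eq 3)
  · exact two hE (by simp [repTwist]) (by simp [repTwist]) (rep_eq 4)
  · exact two autI_pow_two (by simp [repTwist]) (by simp [repTwist]) (rep_eq 5)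
  · exact two autI_pow_two (by simp [repTwist]) (by simp [repTwist]) (rep_eq 6)
  · exact three autW_pow_three (by simp [repTwist]) (by simp [repTwist]) (rep_eq 7)
  · exact three autW_pow_three (by simp [repTwist]) (by simp [repTwist]) (rep_eq 8)
  · refine orderOf_eq_prime_pow (p := 2) (n := 1) ?_ ?_
    · change ¬ x ^ 2 = 1
      intro h
      refine pairElt_ne_one (toMat_repBase_ne_one 5) 1 1 ((rep_eq 5).symm.trans h)
    · change x ^ 4 = 1
      rw [x, ← map_pow, autX_pow_four, map_one]

end Representatives

/-! ### Reaching a representative. -/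

section Existence

theorem isConj_rep_of_eq {g : Hol} {φ : MulAut F2} {w' w s' s : F2} (i : Fin 10)
    (hg : IsConj g (pairElt φ w' w)) (h' : TwConj φ w' s') (h : TwConj φ w s)
    (hi : IsConj (pairElt φ s' s) (rep i)) : ∃ i, IsConj g (rep i) :=
  ⟨i, (hg.trans (isConj_pairElt_of_twConj h' h)).trans hi⟩

/-- The swap exchanges the twist classes of `a⁻¹` and `b⁻¹`, the shear those of 1 and `a⁻¹`. All
permutations of the three classes arise, so only equality of the two coordinates matters. -/
theorem exists_isConj_rep_autI {w' w : F2}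
    (h' : TwConj autI w' 1 ∨ TwConj autI w' genA⁻¹ ∨ TwConj autI w' genB⁻¹)
    (h : TwConj autI w 1 ∨ TwConj autI w genA⁻¹ ∨ TwConj autI w genB⁻¹) :
    ∃ i, IsConj (pairElt autI w' w) (rep i) := by
  have r5 : IsConj (pairElt autI 1 1) (rep 5) := by rw [rep_eq]; exact IsConj.refl _
  have r6 : IsConj (pairElt autI genB⁻¹ 1) (rep 6) := by rw [rep_eq]; exact IsConj.refl _
  have swap : ∀ w' w, IsConj (pairElt autI w' w) (pairElt autI (autP w') (autP w)) := by
    intro w' w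
    have := isConj_pairElt_of_mul_eq (φ := autI) (ψ := autP) (z := 1)
      (aut_ext (by simp) (by simp)) w' w
    simpa using this
  have shear : ∀ w' w, IsConj (pairElt autI w' w)
      (pairElt autI (autT w' * genA) (autT w * genA)) :=
    isConj_pairElt_of_mul_eq (aut_ext (by simp) (by simp [mul_assoc]))
  have tw : TwConj autI genA genA⁻¹ := .inv_of_map_eq_inv autI_genA
  have a1 : IsConj (pairElt autI genA⁻¹ 1) (rep 6) :=
    IsConj.trans (by simpa using swap genA⁻¹ 1) r6
  have aa : IsConj (pairElt autI genA⁻¹ genA⁻¹) (rep 5) :=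
    IsConj.trans (by simpa using shear genA⁻¹ genA⁻¹) r5
  have bb : IsConj (pairElt autI genB⁻¹ genB⁻¹) (rep 5) :=
    IsConj.trans (by simpa using swap genB⁻¹ genB⁻¹) aa
  have oa : IsConj (pairElt autI 1 genA⁻¹) (rep 6) := by
    have h1 : IsConj (pairElt autI 1 genA⁻¹) (pairElt autI genA 1) := by
      simpa using shear 1 genA⁻¹
    exact (h1.trans (isConj_pairElt_of_twConj tw (.refl _ _))).trans a1
  have ob : IsConj (pairElt autI 1 genB⁻¹) (rep 6) :=
    IsConj.trans (by simpa using swap 1 genB⁻¹) oa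
  have ba : IsConj (pairElt autI genB⁻¹ genA⁻¹) (rep 6) :=
    IsConj.trans (by simpa using shear genB⁻¹ genA⁻¹) r6
  have ab : IsConj (pairElt autI genA⁻¹ genB⁻¹) (rep 6) :=
    IsConj.trans (by simpa using swap genA⁻¹ genB⁻¹) ba
  rcases h' with h' | h' | h' <;> rcases h with h | h | h
  · exact isConj_rep_of_eq 5 (.refl _) h' h r5
  · exact isConj_rep_of_eq 6 (.refl _) h' h oa
  · exact isConj_rep_of_eq 6 (.refl _) h' h ob
  · exact isConj_rep_of_eq 6 (.refl _) h' h a1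
  · exact isConj_rep_of_eq 5 (.refl _) h' h aa
  · exact isConj_rep_of_eq 6 (.refl _) h' h ab
  · exact isConj_rep_of_eq 6 (.refl _) h' h r6
  · exact isConj_rep_of_eq 6 (.refl _) h' h ba
  · exact isConj_rep_of_eq 5 (.refl _) h' h bb

theorem exists_isConj_rep_autE {w' w : F2} (h' : TwConj autE w' 1 ∨ TwConj autE w' genA⁻¹)
    (h : TwConj autE w 1 ∨ TwConj autE w genA⁻¹) :
    ∃ i, IsConj (pairElt autE w' w) (rep i) := by
  rcases h' with h' | h' <;> rcases h with h | h
  · exact isConj_rep_of_eq 1 (.refl _) h' h (by rw [rep_eq]; exact IsConj.refl _)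
  -- Representative 4 carries the twist `a⁻²`, which is twisted conjugate to 1.
  · refine isConj_rep_of_eq 4 (.refl _) (s' := genA⁻¹ * genA⁻¹) (h'.trans ⟨genA, by simp⟩) h
      (by rw [rep_eq]; exact IsConj.refl _)
  · exact isConj_rep_of_eq 2 (.refl _) h' h (by rw [rep_eq]; exact IsConj.refl _)
  · exact isConj_rep_of_eq 3 (.refl _) h' h (by rw [rep_eq]; exact IsConj.refl _)

/-- The inversion commutes with `autW` up to an inner automorphism and exchanges the two twist
classes in both coordinates. -/
theorem exists_isConj_rep_autW {w' w : F2} (h' : TwConj autW w' 1 ∨ TwConj autW w' genB⁻¹)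
    (h : TwConj autW w 1 ∨ TwConj autW w genB⁻¹) :
    ∃ i, IsConj (pairElt autW w' w) (rep i) := by
  have r7 : IsConj (pairElt autW 1 1) (rep 7) := by rw [rep_eq]; exact IsConj.refl _
  have r8 : IsConj (pairElt autW genB⁻¹ 1) (rep 8) := by rw [rep_eq]; exact IsConj.refl _
  have flip : ∀ w' w, IsConj (pairElt autW w' w)
      (pairElt autW (autI w' * genB⁻¹) (autI w * genB⁻¹)) :=
    isConj_pairElt_of_mul_eq (aut_ext (by simp) (by simp [mul_assoc]))
  rcases h' with h' | h' <;> rcases h with h | h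
  · exact isConj_rep_of_eq 7 (.refl _) h' h r7
  · exact isConj_rep_of_eq 8 (.refl _) h' h (IsConj.trans (by simpa using flip 1 genB⁻¹) r8)
  · exact isConj_rep_of_eq 8 (.refl _) h' h r8
  · exact isConj_rep_of_eq 7 (.refl _) h' h (IsConj.trans (by simpa using flip genB⁻¹ genB⁻¹) r7)

theorem exists_isConj_rep {g : Hol} (hg : IsOfFinOrder g) (hg1 : g ≠ 1) :
    ∃ i, IsConj g (rep i) := by
  obtain ⟨n, hn, hgn⟩ := isOfFinOrder_iff_pow_eq_one.1 hg
  have hM : toMat g.right ^ n = 1 := by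
    have h1 : g.right ^ n = 1 := by
      have := congrArg SemidirectProduct.rightHom hgn
      rwa [map_pow, map_one] at this
    rw [← map_pow, h1, map_one]
  obtain ⟨N, ⟨ψ, hψ⟩, hN⟩ := exists_standard hn hM
  have main : ∀ φ, N = toMat φ → ∃ w' w, IsConj g (pairElt φ w' w) ∧ pairElt φ w' w ^ n = 1 := by
    intro φ hφ
    obtain ⟨w', w, h⟩ := exists_isConj_pairElt (hφ.symm.trans hψ)
    refine ⟨w', w, h, ?_⟩
    have := h.pow n
    rwa [hgn, isConj_one_right] at this
  have pos : ∀ {k : ℕ}, 0 < k → 0 < n * k := fun hk => Nat.mul_pos hn hk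
  rcases hN with hN | hN | hN | hN | hN | hN | hN
  · obtain ⟨w', w, h, hpow⟩ := main 1 (by rw [hN, map_one])
    obtain ⟨h1, h2⟩ := twistedPow_of_pairElt hpow (pow_one 1)
    rw [eq_one_of_twistedPow_one (pos one_pos) h1, eq_one_of_twistedPow_one (pos one_pos) h2] at h
    refine absurd ?_ hg1
    have e : pairElt 1 1 1 = 1 := SemidirectProduct.ext (by simp [pairElt]) (by simp [pairElt])
    rwa [e, isConj_comm, isConj_one_right] at h
  · obtain ⟨w', w, h, hpow⟩ := main autI (by
      rw [hN, toMat_autI]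
      decide)
    obtain ⟨h1, h2⟩ := twistedPow_of_pairElt hpow autI_pow_two
    obtain ⟨i, hi⟩ := exists_isConj_rep_autI (twConj_autI (pos two_pos) h1)
      (twConj_autI (pos two_pos) h2)
    exact ⟨i, h.trans hi⟩
  · obtain ⟨w', w, h, hpow⟩ := main autE hN
    obtain ⟨h1, h2⟩ := twistedPow_of_pairElt hpow ((pow_two _).trans autE_mul_self)
    obtain ⟨i, hi⟩ := exists_isConj_rep_autE (twConj_autE (pos two_pos) h1)
      (twConj_autE (pos two_pos) h2)
    exact ⟨i, h.trans hi⟩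
  · obtain ⟨w', w, h, hpow⟩ := main autP hN
    obtain ⟨h1, h2⟩ := twistedPow_of_pairElt hpow ((pow_two _).trans autP_mul_self)
    exact isConj_rep_of_eq 0 h (twConj_autP (pos two_pos) h1) (twConj_autP (pos two_pos) h2)
      (by rw [rep_eq]; exact IsConj.refl _)
  · obtain ⟨w', w, h, hpow⟩ := main autX hN
    obtain ⟨h1, h2⟩ := twistedPow_of_pairElt hpow autX_pow_four
    exact isConj_rep_of_eq 9 h (twConj_autX (pos four_pos) h1) (twConj_autX (pos four_pos) h2)
      (by rw [rep_eq]; exact IsConj.refl _)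
  · obtain ⟨w', w, h, hpow⟩ := main autY hN
    have := congrArg SemidirectProduct.rightHom hpow
    rw [map_pow, map_one] at this
    exact absurd this (conj_mul_autY_pow_ne_one w hn)
  · obtain ⟨w', w, h, hpow⟩ := main autW (by rw [hN, toMat_autW])
    obtain ⟨h1, h2⟩ := twistedPow_of_pairElt hpow autW_pow_three
    obtain ⟨i, hi⟩ := exists_isConj_rep_autW (twConj_autW (pos three_pos) h1)
      (twConj_autW (pos three_pos) h2)
    exact ⟨i, h.trans hi⟩

end Existence

/-! ### The representatives are pairwise non-conjugate. -/

section Uniqueness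

theorem twConj_one_of_isConj {φ : MulAut F2} {s : F2}
    (h : IsConj (pairElt φ 1 1) (pairElt φ s 1)) : TwConj φ s 1 := by
  obtain ⟨c, hc⟩ := isConj_iff.1 h
  rw [mul_inv_eq_iff_eq_mul] at hc
  refine ⟨c.left, ?_⟩
  have h1 := congrArg SemidirectProduct.left hc
  simp [pairElt] at h1
  rw [mul_one, eq_mul_inv_iff_mul_eq]
  exact h1.symm

/-- The conjugator's matrix commutes with the reflection, hence is diagonal with entries ±1, and the
conjugator is `τ_u d` with `d` commuting with `autE`. Then `u d(s) = t autE(u)`, and the exponent of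
`a` changes by an even number up to sign. -/
theorem parity_of_isConj {s t : F2} (h : IsConj (MulAut.conj s * autE) (MulAut.conj t * autE)) :
    (ex 0 s - ex 0 t) % 2 = 0 := by
  obtain ⟨C, hC⟩ := isConj_iff.1 h
  rw [mul_inv_eq_iff_eq_mul] at hC
  have hcomm : toMat C * toMat autE = toMat autE * toMat C := by
    have := congrArg toMat hC
    simpa only [map_mul, toMat_conj, one_mul] using this
  have hunit : toMat C * toMat C⁻¹ = 1 := MatConj.toMat_mul_inv C
  have hdiag : ∃ d, toMat C = toMat d ∧ d * autE = autE * d ∧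
      ∀ u, ex 0 (d u) = ex 0 u ∨ ex 0 (d u) = -ex 0 u := by
    rw [toMat_autE, Matrix.eta_fin_two (toMat C)] at hcomm
    simp at hcomm
    have hdet := congrArg Matrix.det hunit
    rw [Matrix.det_mul, Matrix.det_one, Matrix.det_fin_two (toMat C)] at hdet
    have hb : toMat C 0 1 = 0 := by omega
    have hc : toMat C 1 0 = 0 := by omega
    rw [hb, hc, mul_zero, sub_zero, mul_assoc] at hdet
    have ha : toMat C 0 0 = 1 ∨ toMat C 0 0 = -1 :=
      Int.isUnit_iff.1 (IsUnit.of_mul_eq_one _ hdet)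
    have hd : toMat C 1 1 = 1 ∨ toMat C 1 1 = -1 :=
      Int.isUnit_iff.1 (IsUnit.of_mul_eq_one _ (by rw [mul_left_comm] at hdet; exact hdet))
    rcases ha with ha | ha <;> rcases hd with hd | hd <;>
      rw [Matrix.eta_fin_two (toMat C), ha, hb, hc, hd]
    · exact ⟨1, by simp [toMat_apply], by simp, by simp⟩
    · refine ⟨autI * autE, by simp [toMat_apply], aut_ext (by simp) (by simp), fun u => ?_⟩
      rw [ex_apply]
      simp [toMat_apply]
    · refine ⟨autE, by simp [toMat_apply], rfl, fun u => ?_⟩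
      rw [ex_apply]
      simp [toMat_apply]
    · refine ⟨autI, by simp [toMat_apply], aut_ext (by simp) (by simp), fun u => ?_⟩
      rw [ex_apply]
      simp [toMat_apply]
  obtain ⟨d, hd, hdE, hds⟩ := hdiag
  obtain ⟨u, hu⟩ := exists_conj_of_toMat_eq_one (φ := C * d⁻¹) (by
    rw [map_mul, hd, MatConj.toMat_mul_inv])
  obtain rfl : C = MulAut.conj u * d := by rw [← hu, inv_mul_cancel_right]
  have e : MulAut.conj (u * d s) * (autE * d) = MulAut.conj (t * autE u) * (autE * d) := by
    calc MulAut.conj (u * d s) * (autE * d)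
        = MulAut.conj u * (MulAut.conj (d s) * d) * autE := by
          rw [← hdE, map_mul]; simp only [mul_assoc]
      _ = MulAut.conj u * d * (MulAut.conj s * autE) := by
          rw [← mul_conj]; simp only [mul_assoc]
      _ = MulAut.conj t * (autE * MulAut.conj u) * d := by rw [hC]; simp only [mul_assoc]
      _ = MulAut.conj (t * autE u) * (autE * d) := by
          rw [mul_conj, map_mul]; simp only [mul_assoc]
  have e2 := congrArg (ex 0) (conj_injective (mul_right_cancel e))
  have hEu : ex 0 (autE u) = -ex 0 u := by
    rw [ex_apply]
    simp [toMat_apply]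
  rw [ex_mul, ex_mul, hEu] at e2
  have := hds s
  omega

/-- The matrices of the five conjugacy classes of outer automorphisms that occur. -/
def kindMat : Fin 5 → Mat :=
  ![!![0, 1; 1, 0], !![-1, 0; 0, 1], !![-1, 0; 0, -1], !![0, 1; -1, -1], !![0, 1; -1, 0]]

/-- The outer conjugacy classes of the ten representatives. -/
def repKind : Fin 10 → Fin 5 := ![0, 1, 1, 1, 1, 2, 2, 3, 3, 4]

theorem toMat_repBase (i : Fin 10) : toMat (repBase i) = kindMat (repKind i) := by
  fin_cases i
  · exact toMat_autP
  · exact toMat_autE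
  · exact toMat_autE
  · exact toMat_autE
  · exact toMat_autE
  · exact toMat_autI
  · exact toMat_autI
  · exact toMat_autW
  · exact toMat_autW
  · exact toMat_autX

/-- An intertwining matrix has rows `(s, -s)` and `(t, t)`, so its determinant is even. -/
theorem not_matConj_swap_reflection : ¬ MatConj !![0, 1; 1, 0] !![-1, 0; 0, 1] := by
  rintro ⟨ψ, h⟩
  have h1 := congrArg (· * toMat ψ) h
  simp only [mul_assoc, MatConj.toMat_inv_mul, mul_one] at h1
  have hdet := congrArg Matrix.det (MatConj.toMat_mul_inv ψ)
  rw [Matrix.det_mul, Matrix.det_one, Matrix.det_fin_two (toMat ψ)] at hdet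
  rw [Matrix.eta_fin_two (toMat ψ)] at h1
  simp at h1
  have e1 : toMat ψ 0 1 = -toMat ψ 0 0 := by omega
  have e2 : toMat ψ 1 1 = toMat ψ 1 0 := by omega
  rw [e1, e2] at hdet
  have : 2 * (toMat ψ 0 0 * toMat ψ 1 0 * (toMat ψ⁻¹).det) = 1 := by linarith
  omega

theorem MatConj.symm {M N : Mat} (h : MatConj M N) : MatConj N M := by
  obtain ⟨ψ, rfl⟩ := h
  refine ⟨ψ⁻¹, ?_⟩
  rw [inv_inv, mul_assoc, mul_assoc, MatConj.toMat_inv_mul, mul_one, ← mul_assoc,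
    MatConj.toMat_inv_mul, one_mul]

theorem eq_of_matConj_kindMat {k l : Fin 5} (h : MatConj (kindMat k) (kindMat l)) : k = l := by
  have ht := h.trace_eq
  have hd := h.det_eq
  have key : ∀ k l : Fin 5, (kindMat l).trace = (kindMat k).trace →
      (kindMat l).det = (kindMat k).det → k = l ∨ (k = 0 ∧ l = 1) ∨ (k = 1 ∧ l = 0) := by
    simp only [Matrix.trace_fin_two, Matrix.det_fin_two]
    decide
  rcases key k l ht hd with h1 | ⟨rfl, rfl⟩ | ⟨rfl, rfl⟩
  · exact h1
  · exact absurd h not_matConj_swap_reflection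
  · exact absurd h.symm not_matConj_swap_reflection

theorem toMat_right_pairElt (φ : MulAut F2) (w' w : F2) :
    toMat (pairElt φ w' w).right = toMat φ := by
  simp only [pairElt, map_mul, toMat_conj, one_mul]

theorem repKind_eq_of_isConj {i j : Fin 10} (h : IsConj (rep i) (rep j)) :
    repKind i = repKind j := by
  apply eq_of_matConj_kindMat
  rw [← toMat_repBase, ← toMat_repBase]
  rw [rep_eq, rep_eq] at h
  obtain ⟨c, hc⟩ := isConj_iff.1 h
  refine ⟨c.right, ?_⟩
  have := congrArg (fun g : Hol => toMat g.right) hc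
  simp only [SemidirectProduct.mul_right, SemidirectProduct.inv_right, map_mul,
    toMat_right_pairElt] at this
  exact this.symm

theorem eq_of_isConj_rep {i j : Fin 10} (h : IsConj (rep i) (rep j)) : i = j := by
  have key : ∀ i j : Fin 10, repKind i = repKind j → i = j ∨ (repKind i = 1 ∧ repKind j = 1) ∨
      (i = 5 ∧ j = 6) ∨ (i = 6 ∧ j = 5) ∨ (i = 7 ∧ j = 8) ∨ (i = 8 ∧ j = 7) := by
    decide
  -- All exponent sums of `u (autI u)⁻¹` are even.
  have h56 : ¬ IsConj (rep 5) (rep 6) := by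
    intro h
    rw [rep_eq, rep_eq] at h
    obtain ⟨u, hu⟩ := twConj_one_of_isConj h
    have h1 := congrArg (ex 1) hu
    change ex 1 genB⁻¹ = ex 1 (u * 1 * (autI u)⁻¹) at h1
    rw [ex_mul, ex_inv, ex_inv, ex_apply] at h1
    simp [toMat_autI] at h1
    omega
  -- The two exponent sums of `u (autW u)⁻¹` are congruent modulo 3, those of `b⁻¹` are not.
  have h78 : ¬ IsConj (rep 7) (rep 8) := by
    intro h
    rw [rep_eq, rep_eq] at h
    obtain ⟨u, hu⟩ := twConj_one_of_isConj h
    have h0 := congrArg (ex 0) hu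
    have h1 := congrArg (ex 1) hu
    change ex 0 genB⁻¹ = ex 0 (u * 1 * (autW u)⁻¹) at h0
    change ex 1 genB⁻¹ = ex 1 (u * 1 * (autW u)⁻¹) at h1
    rw [ex_mul, ex_inv, ex_inv, ex_apply] at h0 h1
    simp [toMat_autW] at h0 h1
    omega
  rcases key i j (repKind_eq_of_isConj h) with h1 | ⟨hi, hj⟩ | ⟨rfl, rfl⟩ | ⟨rfl, rfl⟩ |
    ⟨rfl, rfl⟩ | ⟨rfl, rfl⟩
  · exact h1
  · have hbase : ∀ i, repKind i = 1 → repBase i = autE := by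
      intro i hi
      fin_cases i <;> first | rfl | exact absurd hi (by decide)
    rw [rep_eq, rep_eq, hbase i hi, hbase j hj] at h
    -- The parities of the exponent of `a` in the two twists take all four values on the four
    -- reflection representatives.
    have p1 := parity_of_isConj (SemidirectProduct.rightHom.map_isConj h)
    have p2 := holToAut.map_isConj h
    rw [holToAut_pairElt, holToAut_pairElt] at p2
    replace p2 := parity_of_isConj p2
    fin_cases i <;> first
      | exact absurd hi (by decide)
      | (fin_cases j <;> first
          | rfl
          | exact absurd hj (by decide)
          | (exfalso; simp [repTwist] at p1 p2))
  · exact absurd h h56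
  · exact absurd h.symm h56
  · exact absurd h h78
  · exact absurd h.symm h78

end Uniqueness

end HolF2

theorem mainTheorem4 :
    (∀ g : HolF2.Hol, IsOfFinOrder g → g ≠ 1 → ∃! i : Fin 10, IsConj g (HolF2.rep i)) ∧
      ∀ i : Fin 10, orderOf (HolF2.rep i) = HolF2.repOrder i := by
  refine ⟨fun g hg hg1 => ?_, HolF2.orderOf_rep⟩
  obtain ⟨i, hi⟩ := HolF2.exists_isConj_rep hg hg1
  exact ⟨i, hi, fun j hj => HolF2.eq_of_isConj_rep (hj.symm.trans hi)⟩
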